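/- For $a,b,c\in\mathbb C$ with $c\notin\mathbb Z_{\le 0}$, let $F(a,b,c\,|\,z)$ denote the analytic continuation to $\mathbb C\setminus[1,\infty)$ of the Gauss hypergeometric series $\sum_{n\ge 0}\frac{(a)_n(b)_n}{(c)_n\,n!}z^n$ ($|z|<1$), and for real $x>1$ put $F(a,b,c\,|\,x)=\lim_{\epsilon\downarrow 0}F(a,b,c\,|\,x+\epsilon i)$. Then for all $t\in\mathbb C$ the continuation and the limit below exist and $$F\left(3t,\,t+\tfrac16,\,\tfrac12\,\middle|\,9\right)=\frac{1}{2\cdot 64^{t}}\left(1+e^{2\pi i\left(t+\frac16\right)}-e^{4\pi i\left(t+\frac16\right)}\right),$$ where $64^t=e^{t\log 64}$ with the real logarithm. -/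

import Mathlib

open Filter Topology

/-- The cut plane `ℂ ∖ [1, ∞)`. -/
def cutPlane : Set ℂ := {z : ℂ | z.re < 1 ∨ z.im ≠ 0}

/-- `f` is the analytic continuation to `ℂ ∖ [1, ∞)` of the Gauss hypergeometric series
`F(a, b, c | z) = ∑ (a)ₙ (b)ₙ / ((c)ₙ n!) zⁿ`, `|z| < 1` (for `c ≠ 0, -1, -2, …`).
Since `ℂ ∖ [1, ∞)` is connected, such an `f` is uniquely determined there. -/
structure IsHypergeometricContinuation (a b c : ℂ) (f : ℂ → ℂ) : Prop where
  analytic : AnalyticOnNhd ℂ f cutPlane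
  eq_series : ∀ z : ℂ, ‖z‖ < 1 → f z = ordinaryHypergeometric a b c z

/-- `F(a, b, c | x) = v` for a real `x > 1`, in the sense of boundary values from the upper half
plane: the hypergeometric series has an analytic continuation `F(a, b, c | ·)` to `ℂ ∖ [1, ∞)`,
and `F(a, b, c | x + ε i) → v` as `ε ↓ 0`. -/
def HypergeometricUpperValue (a b c : ℂ) (x : ℝ) (v : ℂ) : Prop :=
  (∃ f : ℂ → ℂ, IsHypergeometricContinuation a b c f) ∧
    ∀ f : ℂ → ℂ, IsHypergeometricContinuation a b c f →
      Tendsto (fun ε : ℝ => f ((x : ℂ) + (ε : ℂ) * Complex.I)) (𝓝[>] 0) (𝓝 v)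

/-! Put b = 2t + 1/3. The substitution z = (2x - 1)² turns the hypergeometric equation with
parameters 3t, t + 1/6, 1/2 into the one with parameters 3b - 1, b, 2b. Its exponent differences at
0, 1, ∞ agree up to sign, so it admits the symmetries of the three singular points: the reflection S
: x ↦ 1 - x and, with a factor (1 - x)^(1 - 3b), the rotation R : x ↦ 1 / (1 - x). The even solution
e(x) = F((2x - 1)²) has e(2) = F(9), and R carries 1/2 to 2. If R e = α e + β o with o the odd
solution, evaluation at 1/2, where e = 1 and o = 0, gives F(9) = α / 64^t; β plays no role.

The coefficient α is found from traces, without Gamma functions. In the basis e, o the diagonal of R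
is α, δ. At the fixed point p = exp(πi/3) of the rotation, R acts triangularly on 1-jets, so its
trace is τ = exp(πib) and its determinant τ². Hence α + δ = τ. The composite R S is Pfaff's
transformation, which fixes F(3b - 1, b, 2b | x). So R S has eigenvalue 1 and determinant -τ², and α
- δ = 1 - τ². Thus α = (1 + τ - τ²) / 2. When 2b is a nonpositive integer, another eigenfunction is
used, with eigenvalue s = ±1; s = -1 occurs only if τ² = 1, where the same trace results.

The main lemmas are `exists_solution_cutPlane` (continuation), `exists_pfaff_eigenfunction`,
`coefficient_of_jets` (the trace computation) and `rotate_even_solution`. -/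

/-! ### Power series in the unit disc. -/

/-- The power series with coefficients `a` has radius of convergence at least `1`. -/
def UnitDiscCoeff (a : ℕ → ℂ) : Prop :=
  ∀ s : ℝ, 0 < s → s < 1 → ∃ K : ℝ, ∀ n, ‖a n‖ * s ^ n ≤ K

/-- The coefficients of the termwise derivative. -/
def derivCoeff (a : ℕ → ℂ) (n : ℕ) : ℂ := (n + 1) * a (n + 1)

theorem UnitDiscCoeff.summable_norm {a : ℕ → ℂ} (ha : UnitDiscCoeff a) {r : ℝ} (hr0 : 0 ≤ r)
    (hr : r < 1) : Summable fun n => ‖a n‖ * r ^ n := by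
  obtain ⟨K, hK⟩ := ha ((r + 1) / 2) (by linarith) (by linarith)
  have hs : 0 < (r + 1) / 2 := by linarith
  have hq : r / ((r + 1) / 2) < 1 := by rw [div_lt_one hs]; linarith
  refine Summable.of_nonneg_of_le (fun n => by positivity) (fun n => ?_)
    ((summable_geometric_of_lt_one (by positivity) hq).mul_left K)
  have : ‖a n‖ * r ^ n = (‖a n‖ * ((r + 1) / 2) ^ n) * (r / ((r + 1) / 2)) ^ n := by
    rw [mul_assoc, ← mul_pow, mul_div_cancel₀ _ hs.ne']
  rw [this]
  exact mul_le_mul_of_nonneg_right (hK n) (by positivity)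

/-- A bound at the midpoint r of s and 1 suffices: the extra factor n + 1 is absorbed because n (s /
r)^n is bounded. -/
theorem UnitDiscCoeff.derivCoeff {a : ℕ → ℂ} (ha : UnitDiscCoeff a) :
    UnitDiscCoeff (derivCoeff a) := by
  intro s hs0 hs1
  obtain ⟨K, hK⟩ := ha ((s + 1) / 2) (by linarith) (by linarith)
  set r := (s + 1) / 2 with hr
  have hr0 : 0 < r := by rw [hr]; linarith
  have hq : s / r < 1 := by rw [div_lt_one hr0]; linarith
  have hsum := summable_pow_mul_geometric_of_norm_lt_one (R := ℝ) 1 (r := s / r)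
    (by rwa [Real.norm_of_nonneg (by positivity)])
  obtain ⟨M, hM⟩ := hsum.tendsto_atTop_zero.bddAbove_range
  have hM' : ∀ n : ℕ, (n : ℝ) * (s / r) ^ n ≤ M := fun n => by
    simpa using hM ⟨n, rfl⟩
  have hK0 : 0 ≤ K := (by positivity : (0 : ℝ) ≤ ‖a 0‖ * r ^ 0).trans (hK 0)
  refine ⟨K * M / s, fun n => ?_⟩
  have h1 : ‖_root_.derivCoeff a n‖ * s ^ n
      = (‖a (n + 1)‖ * r ^ (n + 1)) * (((n + 1 : ℕ) : ℝ) * (s / r) ^ (n + 1)) / s := by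
    have : ‖(n : ℂ) + 1‖ = n + 1 := by
      rw [← Nat.cast_succ, Complex.norm_natCast]; push_cast; rfl
    have h2 : r ^ (n + 1) * (s / r) ^ (n + 1) = s ^ n * s := by
      rw [← mul_pow, mul_div_cancel₀ _ hr0.ne', pow_succ]
    rw [_root_.derivCoeff, norm_mul, this, eq_div_iff hs0.ne']
    push_cast
    linear_combination (-‖a (n + 1)‖ * (n + 1)) * h2
  rw [h1]
  gcongr
  · exact hK _
  · exact hM' _

theorem UnitDiscCoeff.hasSum {a : ℕ → ℂ} (ha : UnitDiscCoeff a) {z : ℂ} (hz : ‖z‖ < 1) :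
    HasSum (fun n => a n * z ^ n) (∑' n, a n * z ^ n) := by
  refine Summable.hasSum (Summable.of_norm ?_)
  simpa using ha.summable_norm (norm_nonneg z) hz

theorem UnitDiscCoeff.hasDerivAt {a : ℕ → ℂ} (ha : UnitDiscCoeff a) {z : ℂ} (hz : ‖z‖ < 1) :
    HasDerivAt (fun z => ∑' n, a n * z ^ n) (∑' n, _root_.derivCoeff a n * z ^ n) z := by
  obtain ⟨r, hzr, hr⟩ := exists_between hz
  have hr0 : 0 ≤ r := (norm_nonneg z).trans hzr.le
  have hterm : ∀ w : ℂ, ‖w‖ < 1 → Summable fun n => a n * (n * w ^ (n - 1)) := fun w hw => by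
    rw [← summable_nat_add_iff 1]
    refine (ha.derivCoeff.hasSum hw).summable.congr fun n => ?_
    simp [_root_.derivCoeff]; ring
  have hu : Summable fun n => ‖a n‖ * (n * r ^ (n - 1)) := by
    rw [← summable_nat_add_iff 1]
    refine (ha.derivCoeff.summable_norm hr0 hr).congr fun n => ?_
    have : ‖(n : ℂ) + 1‖ = n + 1 := by
      rw [← Nat.cast_succ, Complex.norm_natCast]; push_cast; rfl
    simp [_root_.derivCoeff, this]; ring
  have key := hasDerivAt_tsum_of_isPreconnected (g := fun n z => a n * z ^ n)
    (g' := fun n z => a n * (n * z ^ (n - 1))) (t := Metric.ball 0 r) (y₀ := 0) hu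
    Metric.isOpen_ball (convex_ball _ _).isPreconnected
    (fun n y _ => (hasDerivAt_pow n y).const_mul (a n)) (fun n y hy => ?_)
    (Metric.mem_ball_self ((norm_nonneg z).trans_lt hzr))
    (ha.hasSum (by simp)).summable (y := z) (by simpa using hzr)
  · convert! key using 1
    rw [(hterm z hz).tsum_eq_zero_add]
    simp only [Nat.cast_zero, zero_mul, mul_zero, zero_add]
    refine tsum_congr fun n => ?_
    simp [_root_.derivCoeff]; ring
  · have : ‖y‖ ≤ r := by simpa using (Metric.mem_ball.1 hy).le
    simp only [norm_mul, norm_pow, Complex.norm_natCast]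
    gcongr

theorem UnitDiscCoeff.deriv_deriv {a : ℕ → ℂ} (ha : UnitDiscCoeff a) {z : ℂ} (hz : ‖z‖ < 1) :
    deriv (deriv fun z => ∑' n, a n * z ^ n) z
      = ∑' n, _root_.derivCoeff (_root_.derivCoeff a) n * z ^ n := by
  have : deriv (fun z => ∑' n, a n * z ^ n) =ᶠ[𝓝 z]
      fun z => ∑' n, _root_.derivCoeff a n * z ^ n := by
    filter_upwards [Metric.isOpen_ball.mem_nhds (x := z) (s := Metric.ball 0 1) (by simpa using hz)]
      with w hw
    exact (ha.hasDerivAt (by simpa using hw)).deriv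
  rw [this.deriv_eq, (ha.derivCoeff.hasDerivAt hz).deriv]

theorem UnitDiscCoeff.analyticOnNhd {a : ℕ → ℂ} (ha : UnitDiscCoeff a) :
    AnalyticOnNhd ℂ (fun z => ∑' n, a n * z ^ n) (Metric.ball 0 1) :=
  DifferentiableOn.analyticOnNhd (fun z hz =>
    (ha.hasDerivAt (by simpa using hz)).differentiableAt.differentiableWithinAt)
    Metric.isOpen_ball

/-- A solution of a linear three-term recurrence whose limiting coefficients satisfy
`|p| + |q| ≤ 1` gives a power series converging in the unit disc. -/
theorem unitDiscCoeff_of_recurrence {a p q : ℕ → ℂ} {P Q : ℝ}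
    (hrec : ∀ n, a (n + 2) = p n * a (n + 1) + q n * a n)
    (hp : Tendsto (fun n => ‖p n‖) atTop (𝓝 P)) (hq : Tendsto (fun n => ‖q n‖) atTop (𝓝 Q))
    (hPQ : P + Q ≤ 1) : UnitDiscCoeff a := by
  intro s hs0 hs1
  have hP : 0 ≤ P := ge_of_tendsto' hp fun n => norm_nonneg _
  have hQ : 0 ≤ Q := ge_of_tendsto' hq fun n => norm_nonneg _
  have hlt : P * s + Q * s ^ 2 < 1 := by
    rcases hP.eq_or_lt with h | h
    · rw [← h]; nlinarith
    · nlinarith [mul_lt_mul_of_pos_left hs1 h, mul_le_mul_of_nonneg_left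
        (by nlinarith : s ^ 2 ≤ 1) hQ]
  obtain ⟨N, hN⟩ := eventually_atTop.1
    (((hp.mul_const s).add (hq.mul_const (s ^ 2))).eventually_lt_const hlt)
  set b : ℕ → ℝ := fun n => ‖a n‖ * s ^ n with hb
  have hb0 : ∀ n, 0 ≤ b n := fun n => by positivity
  -- Beyond N the weights satisfy ‖p n‖ s + ‖q n‖ s² < 1, so the maximum of two consecutive terms
  -- never increases.
  have hstep : ∀ n, N ≤ n → b (n + 2) ≤ max (b n) (b (n + 1)) := fun n hn => by
    have h1 : b (n + 2) ≤ ‖p n‖ * s * b (n + 1) + ‖q n‖ * s ^ 2 * b n := by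
      calc b (n + 2) = ‖p n * a (n + 1) + q n * a n‖ * s ^ (n + 2) := by simp [hb, hrec]
        _ ≤ (‖p n‖ * ‖a (n + 1)‖ + ‖q n‖ * ‖a n‖) * s ^ (n + 2) := by
            gcongr; exact (norm_add_le _ _).trans (by simp)
        _ = _ := by simp only [hb]; ring
    have hM : 0 ≤ max (b n) (b (n + 1)) := le_max_of_le_left (hb0 n)
    calc b (n + 2) ≤ ‖p n‖ * s * max (b n) (b (n + 1)) + ‖q n‖ * s ^ 2 * max (b n) (b (n + 1)) := by
          refine h1.trans ?_
          gcongr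
          · exact le_max_right _ _
          · exact le_max_left _ _
      _ = (‖p n‖ * s + ‖q n‖ * s ^ 2) * max (b n) (b (n + 1)) := by ring
      _ ≤ 1 * max (b n) (b (n + 1)) := by gcongr; exact (hN n hn).le
      _ = _ := one_mul _
  have hpair : ∀ n, max (b (N + n)) (b (N + n + 1)) ≤ max (b N) (b (N + 1)) := fun n => by
    induction n with
    | zero => simp
    | succ n ih =>
      refine max_le ((le_max_right _ _).trans ih) ((hstep (N + n) (by omega)).trans ih)
  refine ⟨∑ n ∈ Finset.range N, b n + max (b N) (b (N + 1)), fun n => ?_⟩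
  have hsum : 0 ≤ ∑ n ∈ Finset.range N, b n := Finset.sum_nonneg fun n _ => hb0 n
  rcases lt_or_ge n N with h | h
  · have := Finset.single_le_sum (f := b) (fun i _ => hb0 i) (Finset.mem_range.2 h)
    have h2 : 0 ≤ max (b N) (b (N + 1)) := le_max_of_le_left (hb0 N)
    change b n ≤ _
    linarith
  · obtain ⟨m, rfl⟩ := Nat.exists_eq_add_of_le h
    have := (le_max_left _ _).trans (hpair m)
    change b (N + m) ≤ _
    linarith

/-! ### Local uniqueness, and derivatives of a product with a composite. -/

/-- Uniqueness at a (possibly singular) point of a second order linear equation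
`(z - p) P u'' + Q u' + R u = 0`, by the indicial equation. -/
theorem eventually_eq_zero_of_indicial {u P Q R : ℂ → ℂ} {p : ℂ} (hu : AnalyticAt ℂ u p)
    (hP : ContinuousAt P p) (hQ : ContinuousAt Q p) (hR : ContinuousAt R p)
    (hode : ∀ᶠ z in 𝓝 p, (z - p) * P z * deriv (deriv u) z + Q z * deriv u z + R z * u z = 0)
    (hu0 : u p = 0)
    (hind : ∀ m : ℕ, analyticOrderAt u p = m → (m : ℂ) * ((m - 1) * P p + Q p) ≠ 0) :
    ∀ᶠ z in 𝓝 p, u z = 0 := by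
  rw [← analyticOrderAt_eq_top]
  by_contra htop
  obtain ⟨m, hm⟩ := ENat.ne_top_iff_exists.1 htop
  have hm := hm.symm
  have hm0 : m ≠ 0 := by
    rintro rfl
    exact (hu.analyticOrderAt_ne_zero.2 hu0) (by simpa using hm)
  obtain ⟨n, rfl⟩ := Nat.exists_eq_succ_of_ne_zero hm0
  obtain ⟨g, hg, hgp, hug⟩ := (hu.analyticOrderAt_eq_natCast).1 hm
  have hg1 := hg.eventually_analyticAt
  have hd1 : ∀ᶠ z in 𝓝 p, deriv u z = (z - p) ^ n * ((n + 1) * g z + (z - p) * deriv g z) := by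
    filter_upwards [hug.eventually_nhds, hg1] with z hz hgz
    have hz : u =ᶠ[𝓝 z] fun z => (z - p) ^ (n + 1) * g z := hz
    rw [hz.deriv_eq]
    have h := (((hasDerivAt_id z).sub_const p).pow (n + 1)).mul hgz.differentiableAt.hasDerivAt
    refine (HasDerivAt.deriv (by exact h)).trans ?_
    simp; ring
  -- The factor z - p restores the power lost by differentiating (z - p)^n, so the formula also
  -- covers n = 0.
  have hd2 : ∀ᶠ z in 𝓝 p, (z - p) * deriv (deriv u) z = (z - p) ^ n *
      (n * ((n + 1) * g z + (z - p) * deriv g z) +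
        (z - p) * ((n + 2) * deriv g z + (z - p) * deriv (deriv g) z)) := by
    filter_upwards [hd1.eventually_nhds, hg1] with z hz hgz
    have hz : deriv u =ᶠ[𝓝 z] fun z => (z - p) ^ n * ((n + 1) * g z + (z - p) * deriv g z) := hz
    rw [hz.deriv_eq]
    have h := (((hasDerivAt_id z).sub_const p).pow n).mul
      ((hgz.differentiableAt.hasDerivAt.const_mul ((n : ℂ) + 1)).add
        (((hasDerivAt_id z).sub_const p).mul hgz.deriv.differentiableAt.hasDerivAt))
    rw [HasDerivAt.deriv (by exact h)]
    rcases n with _ | n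
    · simp only [CharP.cast_eq_zero, Pi.add_apply, Pi.mul_apply, Pi.pow_apply, id]; ring
    · simp only [Nat.cast_add, Nat.cast_one, Nat.add_sub_cancel, Pi.add_apply, Pi.mul_apply,
        Pi.pow_apply, id]
      ring
  have hev : ∀ᶠ z in 𝓝[≠] p, (P z * (n * ((n + 1) * g z + (z - p) * deriv g z) +
        (z - p) * ((n + 2) * deriv g z + (z - p) * deriv (deriv g) z)) +
      Q z * ((n + 1) * g z + (z - p) * deriv g z)) + R z * ((z - p) * g z) = 0 := by
    filter_upwards [hd1.filter_mono nhdsWithin_le_nhds, hd2.filter_mono nhdsWithin_le_nhds,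
      hug.filter_mono nhdsWithin_le_nhds, hode.filter_mono nhdsWithin_le_nhds,
      self_mem_nhdsWithin] with z h1 h2 h3 h4 h5
    have hz : (z - p) ^ n ≠ 0 := pow_ne_zero _ (sub_ne_zero.2 h5)
    refine mul_left_cancel₀ hz ?_
    simp only [smul_eq_mul, Nat.succ_eq_add_one] at h3
    rw [h1, h3] at h4
    linear_combination h4 - P z * h2
  have hgc := hg.continuousAt
  have hgc1 := hg.deriv.continuousAt
  have hgc2 := hg.deriv.deriv.continuousAt
  have hsub : ContinuousAt (fun z => z - p) p := by fun_prop
  have hcont : ContinuousAt (fun z => (P z * (n * ((n + 1) * g z + (z - p) * deriv g z) +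
        (z - p) * ((n + 2) * deriv g z + (z - p) * deriv (deriv g) z)) +
      Q z * ((n + 1) * g z + (z - p) * deriv g z)) + R z * ((z - p) * g z)) p := by
    fun_prop
  -- After division by (z - p)^n, the limit z → p leaves g p times the indicial polynomial at n + 1.
  have hlim := tendsto_nhds_unique (hcont.tendsto.mono_left (nhdsWithin_le_nhds (s := {p}ᶜ)))
    (tendsto_const_nhds.congr' (hev.mono fun z hz => hz.symm))
  refine hind (n + 1) (by simpa using hm) ?_
  have hlim' : g p * (((n : ℂ) + 1) * (n * P p + Q p)) = 0 := by
    simp only [sub_self, zero_mul, add_zero, mul_zero] at hlim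
    linear_combination hlim
  have := (mul_eq_zero.1 hlim').resolve_left hgp
  push_cast
  linear_combination this

/-- The first two derivatives of `g * (y ∘ h)`. -/
theorem deriv_mul_comp {g g₁ h h₁ y : ℂ → ℂ} {g₂ h₂ x : ℂ}
    (hg : ∀ᶠ w in 𝓝 x, HasDerivAt g (g₁ w) w) (hg₁ : HasDerivAt g₁ g₂ x)
    (hh : ∀ᶠ w in 𝓝 x, HasDerivAt h (h₁ w) w) (hh₁ : HasDerivAt h₁ h₂ x)
    (hy : AnalyticAt ℂ y (h x)) :
    deriv (fun w => g w * y (h w)) x = g₁ x * y (h x) + g x * h₁ x * deriv y (h x) ∧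
    deriv (deriv fun w => g w * y (h w)) x =
      g₂ * y (h x) + (2 * g₁ x * h₁ x + g x * h₂) * deriv y (h x)
        + g x * h₁ x ^ 2 * deriv (deriv y) (h x) := by
  have hhx := hh.self_of_nhds
  have hd : ∀ᶠ w in 𝓝 x, HasDerivAt (fun w => g w * y (h w))
      (g₁ w * y (h w) + g w * (deriv y (h w) * h₁ w)) w := by
    filter_upwards [hg, hh, hhx.continuousAt.eventually hy.eventually_analyticAt] with w h1 h2 h3
    exact h1.mul (h3.differentiableAt.hasDerivAt.comp w h2)
  have hd' : deriv (fun w => g w * y (h w)) =ᶠ[𝓝 x]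
      fun w => g₁ w * y (h w) + g w * (deriv y (h w) * h₁ w) := hd.mono fun w hw => hw.deriv
  refine ⟨by rw [hd'.self_of_nhds]; ring, ?_⟩
  rw [hd'.deriv_eq]
  have h1 := (hg₁.mul (hy.differentiableAt.hasDerivAt.comp x hhx)).add
    (hg.self_of_nhds.mul ((hy.deriv.differentiableAt.hasDerivAt.comp x hhx).mul hh₁))
  refine (HasDerivAt.deriv (by exact h1)).trans ?_
  simp only [Function.comp, Pi.mul_apply]
  ring

/-! ### The hypergeometric equation and its series. -/

/-- `f` satisfies the hypergeometric differential equation with parameters `a`, `b`, `c` at `z`. -/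
def SolvesHypergeometric (a b c : ℂ) (f : ℂ → ℂ) (z : ℂ) : Prop :=
  z * (1 - z) * deriv (deriv f) z + (c - (a + b + 1) * z) * deriv f z - a * b * f z = 0

theorem tendsto_natCast_add_div_natCast_add (x y : ℂ) :
    Tendsto (fun n : ℕ => ((n : ℂ) + x) / (n + y)) atTop (𝓝 1) := by
  have h := (tendsto_natCast_div_add_atTop y).div (tendsto_natCast_div_add_atTop x) one_ne_zero
  rw [div_one] at h
  refine h.congr' ?_
  filter_upwards [eventually_ne_atTop 0] with n hn
  have hn' : (n : ℂ) ≠ 0 := Nat.cast_ne_zero.2 hn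
  simp only [Pi.div_apply]
  by_cases hx : (n : ℂ) + x = 0
  · simp [hx]
  by_cases hy : (n : ℂ) + y = 0
  · simp [hy]
  field_simp

theorem tendsto_const_div_natCast_add (x y : ℂ) :
    Tendsto (fun n : ℕ => x / ((n : ℂ) + y)) atTop (𝓝 0) := by
  have h := (tendsto_natCast_add_div_natCast_add (x + y) y).sub
    (tendsto_natCast_add_div_natCast_add y y)
  rw [sub_self] at h
  refine h.congr fun n => ?_
  rw [← sub_div]
  congr 1
  ring

/-- The quotient form of the hypergeometric coefficients. -/
theorem ordinaryHypergeometricCoefficient_succ (a b c : ℂ) (n : ℕ) :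
    ordinaryHypergeometricCoefficient a b c (n + 1)
      = (n + a) * (n + b) / ((n + 1) * (n + c)) * ordinaryHypergeometricCoefficient a b c n := by
  simp only [ordinaryHypergeometricCoefficient, ascPochhammer_succ_eval, Nat.factorial_succ]
  push_cast
  rw [mul_inv, mul_inv, div_eq_mul_inv, mul_inv]
  ring

theorem unitDiscCoeff_ordinaryHypergeometricCoefficient (a b c : ℂ) :
    UnitDiscCoeff (ordinaryHypergeometricCoefficient a b c) := by
  have h := (tendsto_natCast_add_div_natCast_add (1 + a) 2).mul
    (tendsto_natCast_add_div_natCast_add (1 + b) (1 + c))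
  refine unitDiscCoeff_of_recurrence (fun n => ?_) h.norm (q := 0) (Q := 0) (by simp) (by simp)
  rw [ordinaryHypergeometricCoefficient_succ]
  simp only [Pi.zero_apply, zero_mul, add_zero]
  rw [div_mul_div_comm]
  push_cast
  ring_nf

theorem ordinaryHypergeometric_eq_tsum_coefficient (a b c : ℂ) :
    ordinaryHypergeometric a b c
      = fun z : ℂ => ∑' n, ordinaryHypergeometricCoefficient a b c n * z ^ n := by
  rw [ordinaryHypergeometric_eq_tsum]
  rfl

/-- If `∑ aₙ zⁿ` converges in the unit disc, then `z f' = ∑ n aₙ zⁿ`. -/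
theorem UnitDiscCoeff.hasSum_mul_deriv {a : ℕ → ℂ} (ha : UnitDiscCoeff a) {z : ℂ} (hz : ‖z‖ < 1) :
    HasSum (fun n => n * a n * z ^ n) (z * ∑' n, _root_.derivCoeff a n * z ^ n) := by
  rw [← hasSum_nat_add_iff' 1]
  simp only [Finset.range_one, Finset.sum_singleton, Nat.cast_zero, zero_mul, sub_zero]
  refine ((ha.derivCoeff.hasSum hz).mul_left z).congr_fun fun n => ?_
  simp only [_root_.derivCoeff]
  push_cast
  ring

theorem UnitDiscCoeff.hasSum_sq_mul_deriv {a : ℕ → ℂ} (ha : UnitDiscCoeff a) {z : ℂ}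
    (hz : ‖z‖ < 1) : HasSum (fun n => n * (n - 1) * a n * z ^ n)
      (z ^ 2 * ∑' n, _root_.derivCoeff (_root_.derivCoeff a) n * z ^ n) := by
  rw [← hasSum_nat_add_iff' 1]
  simp only [Finset.range_one, Finset.sum_singleton, Nat.cast_zero, zero_mul, sub_zero]
  rw [pow_two, mul_assoc]
  refine ((ha.derivCoeff.hasSum_mul_deriv hz).mul_left z).congr_fun fun n => ?_
  simp only [_root_.derivCoeff]
  push_cast
  ring

theorem solvesHypergeometric_ordinaryHypergeometric {a b c : ℂ} (hc : ∀ n : ℕ, (n : ℂ) + c ≠ 0)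
    {z : ℂ} (hz : ‖z‖ < 1) : SolvesHypergeometric a b c (ordinaryHypergeometric a b c) z := by
  have ha := unitDiscCoeff_ordinaryHypergeometricCoefficient a b c
  rw [SolvesHypergeometric, ordinaryHypergeometric_eq_tsum_coefficient, ha.deriv_deriv hz,
    (ha.hasDerivAt hz).deriv]
  have h := ((((ha.derivCoeff.hasSum_mul_deriv hz).sub (ha.hasSum_sq_mul_deriv hz)).add
    ((ha.derivCoeff.hasSum hz).mul_left c)).sub ((ha.hasSum_mul_deriv hz).mul_left (a + b + 1))).sub
    ((ha.hasSum hz).mul_left (a * b))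
  have h0 := h.unique (hasSum_zero.congr_fun fun n => ?_)
  · linear_combination h0
  · have h1 : ((n : ℂ) + 1) ≠ 0 := Nat.cast_add_one_ne_zero n
    have h2 := hc n
    simp only [derivCoeff, ordinaryHypergeometricCoefficient_succ]
    field_simp
    ring

/-! ### Continuation to the cut plane through the Koebe map. -/

/-- The coefficients of `(1 + ζ) ^ (-2a) F(a, b, c | 4 ζ / (1 + ζ) ^ 2)`. -/
noncomputable def koebeCoeff (a b c : ℂ) : ℕ → ℂ
  | 0 => 1
  | 1 => (2 * b - c) * (2 * a) / c
  | n + 2 => (2 * (2 * b - c)) / (n + (1 + c)) * ((n + (1 + a)) / (n + 2)) * koebeCoeff a b c (n + 1)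
      + (n + 2 * a) / (n + 2) * ((n + (2 * a + 1 - c)) / (n + (1 + c))) * koebeCoeff a b c n

theorem unitDiscCoeff_koebeCoeff (a b c : ℂ) : UnitDiscCoeff (koebeCoeff a b c) := by
  have h := (tendsto_const_div_natCast_add (2 * (2 * b - c)) (1 + c)).mul
    (tendsto_natCast_add_div_natCast_add (1 + a) 2)
  have h' := (tendsto_natCast_add_div_natCast_add (2 * a) 2).mul
    (tendsto_natCast_add_div_natCast_add (2 * a + 1 - c) (1 + c))
  exact unitDiscCoeff_of_recurrence (fun n => by rw [koebeCoeff]) h.norm h'.norm (by simp)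

/-- The map ζ ↦ 4ζ / (1 + ζ)² sends the unit disc onto the cut plane, and the pulled back equation
has finite singularities only at 0 and ±1. Compared coefficientwise, it is the recurrence defining
`koebeCoeff`. -/
theorem koebe_ode {a b c : ℂ} (hc : ∀ n : ℕ, (n : ℂ) + c ≠ 0) {z : ℂ} (hz : ‖z‖ < 1) :
    let g : ℂ → ℂ := fun z => ∑' n, koebeCoeff a b c n * z ^ n
    z * (1 - z ^ 2) * deriv (deriv g) z +
      (c - (2 - c + 4 * a) * z ^ 2 - (4 * b - 2 * c) * z) * deriv g z -
      (2 * a * (2 * a + 1 - c) * z - (2 * a * c - 4 * a * b)) * g z = 0 := by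
  intro g
  have ha := unitDiscCoeff_koebeCoeff a b c
  rw [ha.deriv_deriv hz, (ha.hasDerivAt hz).deriv]
  have hL := (((ha.derivCoeff.hasSum_mul_deriv hz).add ((ha.derivCoeff.hasSum hz).mul_left c)).sub
    ((ha.hasSum_mul_deriv hz).mul_left (4 * b - 2 * c))).add
    ((ha.hasSum hz).mul_left (2 * a * c - 4 * a * b))
  have hU := (((ha.hasSum_sq_mul_deriv hz).add
    ((ha.hasSum_mul_deriv hz).mul_left (2 - c + 4 * a))).add
    ((ha.hasSum hz).mul_left (2 * a * (2 * a + 1 - c)))).mul_left z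
  -- The terms in `hU` carry a factor z, so the constant term of `hL` is split off and checked by
  -- hand.
  rw [← hasSum_nat_add_iff' 1] at hL
  have h0 := hL.unique (hU.congr_fun fun n => ?_)
  · have hc0 : c ≠ 0 := by simpa using hc 0
    have hd : c * derivCoeff (koebeCoeff a b c) 0 = (2 * b - c) * (2 * a) := by
      simp only [derivCoeff, koebeCoeff]
      field_simp
      simp
    have hk : koebeCoeff a b c 0 = 1 := by rw [koebeCoeff]
    simp only [Finset.range_one, Finset.sum_singleton, hk, Nat.cast_zero,
      zero_add, zero_mul, pow_zero, mul_one, mul_zero, sub_zero, hd] at h0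
    linear_combination h0
  · have h1 : ((n : ℂ) + 2) ≠ 0 := by exact_mod_cast (Nat.cast_ne_zero (R := ℂ)).2 (by omega : n + 2 ≠ 0)
    have h2 : (n : ℂ) + (1 + c) ≠ 0 := by have := hc (n + 1); push_cast at this; rwa [add_assoc] at this
    simp only [derivCoeff, koebeCoeff]
    push_cast
    field_simp
    ring

theorem hasDerivAt_affine_cpow {p q k x : ℂ} (hx : p + q * x ∈ Complex.slitPlane) :
    HasDerivAt (fun x => (p + q * x) ^ k) (k * q * (p + q * x) ^ k / (p + q * x)) x := by
  have h := (((hasDerivAt_id x).const_mul q).const_add p).cpow_const (c := k) hx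
  convert! h using 1
  rw [id, Complex.cpow_sub _ _ (Complex.slitPlane_ne_zero hx), Complex.cpow_one]
  ring

theorem hasDerivAt_affine_cpow' {p q k x : ℂ} (hx : p + q * x ∈ Complex.slitPlane) :
    HasDerivAt (fun x => k * q * (p + q * x) ^ k / (p + q * x))
      (k * (k - 1) * q ^ 2 * (p + q * x) ^ k / (p + q * x) ^ 2) x := by
  have hx0 := Complex.slitPlane_ne_zero hx
  have h := ((hasDerivAt_affine_cpow (k := k) hx).const_mul (k * q)).div
    (((hasDerivAt_id x).const_mul q).const_add p) hx0
  convert! h using 1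
  simp only [id]
  field_simp

theorem eventually_affine_mem_slitPlane {p q x : ℂ} (hx : p + q * x ∈ Complex.slitPlane) :
    ∀ᶠ w in 𝓝 x, p + q * w ∈ Complex.slitPlane :=
  (by fun_prop : ContinuousAt (fun w => p + q * w) x).eventually
    (Complex.isOpen_slitPlane.mem_nhds hx)

theorem mem_cutPlane_iff {z : ℂ} : z ∈ cutPlane ↔ 1 - z ∈ Complex.slitPlane := by
  simp [cutPlane, Complex.mem_slitPlane_iff]

theorem isOpen_cutPlane : IsOpen cutPlane := by
  have : cutPlane = (fun z => 1 - z) ⁻¹' Complex.slitPlane := by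
    ext z; exact mem_cutPlane_iff
  rw [this]
  exact Complex.isOpen_slitPlane.preimage (by fun_prop)

theorem isPreconnected_cutPlane : IsPreconnected cutPlane := by
  have : cutPlane = (fun z => 1 - z) '' Complex.slitPlane := by
    ext z
    rw [mem_cutPlane_iff]
    exact ⟨fun h => ⟨1 - z, h, by ring⟩, by rintro ⟨w, hw, rfl⟩; simpa using hw⟩
  rw [this]
  exact (Complex.starConvex_one_slitPlane.isPathConnected
    Complex.one_mem_slitPlane).isConnected.isPreconnected.image _ (by fun_prop)

theorem ball_subset_cutPlane : Metric.ball (0 : ℂ) 1 ⊆ cutPlane := fun z hz => by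
  left
  exact (Complex.re_le_norm z).trans_lt (by simpa using hz)

theorem zero_mem_cutPlane : (0 : ℂ) ∈ cutPlane := ball_subset_cutPlane (by simp)

theorem re_cpow_half_pos {z : ℂ} (hz : z ∈ Complex.slitPlane) : 0 < (z ^ (1 / 2 : ℂ)).re := by
  rw [Complex.cpow_def_of_ne_zero (Complex.slitPlane_ne_zero hz), Complex.exp_re]
  refine mul_pos (Real.exp_pos _) (Real.cos_pos_of_mem_Ioo ?_)
  have h1 := Complex.neg_pi_lt_arg z
  have h2 : z.arg < Real.pi :=
    lt_of_le_of_ne (Complex.arg_le_pi z) (Complex.mem_slitPlane_iff_arg.1 hz).1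
  have : (Complex.log z * (1 / 2)).im = z.arg / 2 := by
    rw [show (1 / 2 : ℂ) = ((1 / 2 : ℝ) : ℂ) by push_cast; rfl, Complex.im_mul_ofReal,
      Complex.log_im]
    ring
  rw [this]
  constructor <;> linarith

theorem cpow_half_sq {z : ℂ} : (z ^ (1 / 2 : ℂ)) ^ 2 = z := by
  rw [← Complex.cpow_nat_mul]; norm_num

theorem one_add_mem_slitPlane {s : ℂ} (hs : 0 < s.re) : 1 + 1 * s ∈ Complex.slitPlane :=
  Or.inl (by simp; linarith)

theorem norm_koebe_lt_one {s : ℂ} (hs : 0 < s.re) : ‖(1 - s) / (1 + s)‖ < 1 := by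
  have h : (1 + s) ≠ 0 := by simpa using Complex.slitPlane_ne_zero (one_add_mem_slitPlane hs)
  rw [norm_div, div_lt_one (norm_pos_iff.2 h), ← sq_lt_sq₀ (norm_nonneg _) (norm_nonneg _),
    Complex.sq_norm, Complex.sq_norm, Complex.normSq_apply, Complex.normSq_apply]
  simp
  nlinarith

/-- With ζ = (1 - s) / (1 + s) one has 4ζ / (1 + ζ)² = 1 - s² and 1 + ζ = 2 / (1 + s). The result is
the hypergeometric equation in the variable s = √(1 - z), which ranges over the right half plane. -/
theorem koebe_comp_ode {a b c : ℂ} (hc : ∀ n : ℕ, (n : ℂ) + c ≠ 0) {s : ℂ} (hs : 0 < s.re) :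
    let y : ℂ → ℂ := fun s => (1 + 1 * s) ^ (-2 * a) *
      (fun z => ∑' n, koebeCoeff a b c n * z ^ n) ((1 - s) / (1 + s))
    AnalyticAt ℂ y s ∧ s * (1 - s ^ 2) * deriv (deriv y) s - (1 - s ^ 2) * deriv y s
      - 2 * (c - (a + b + 1) * (1 - s ^ 2)) * deriv y s - 4 * a * b * s * y s = 0 := by
  intro y
  set g : ℂ → ℂ := fun z => ∑' n, koebeCoeff a b c n * z ^ n with hg
  have hz := norm_koebe_lt_one hs
  have hsl := one_add_mem_slitPlane hs
  have hne : 1 + s ≠ 0 := by simpa using Complex.slitPlane_ne_zero hsl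
  have hga : AnalyticAt ℂ g ((1 - s) / (1 + s)) :=
    (unitDiscCoeff_koebeCoeff a b c).analyticOnNhd _ (by simpa using hz)
  have hode := koebe_ode (a := a) (b := b) hc hz
  have hh : ∀ w : ℂ, 1 + w ≠ 0 → HasDerivAt (fun s => (1 - s) / (1 + s)) (-2 / (1 + w) ^ 2) w :=
    fun w hw => by
      convert! ((hasDerivAt_id w).const_sub 1).div ((hasDerivAt_id w).const_add 1) hw using 1
      simp only [id]
      ring
  have hh1 : HasDerivAt (fun w : ℂ => -2 / (1 + w) ^ 2) (4 / (1 + s) ^ 3) s := by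
    convert! (hasDerivAt_const s (-2 : ℂ)).div (((hasDerivAt_id s).const_add 1).pow 2)
      (pow_ne_zero 2 hne) using 1
    simp only [id, Pi.pow_apply]
    field_simp
    norm_num
  have hev : ∀ᶠ w in 𝓝 s, 1 + w ≠ 0 :=
    (by fun_prop : ContinuousAt (fun w : ℂ => 1 + w) s).eventually_ne hne
  obtain ⟨e1, e2⟩ := deriv_mul_comp
    ((eventually_affine_mem_slitPlane hsl).mono fun w hw => hasDerivAt_affine_cpow (k := -2 * a) hw)
    (hasDerivAt_affine_cpow' hsl) (hev.mono hh) hh1 hga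
  refine ⟨?_, ?_⟩
  · refine AnalyticAt.mul (AnalyticAt.cpow (by fun_prop) (by fun_prop) hsl) ?_
    exact AnalyticAt.fun_comp (g := g) (f := fun s => (1 - s) / (1 + s)) hga
      (by fun_prop (disch := exact hne))
  · change s * (1 - s ^ 2) * deriv (deriv fun w => (1 + 1 * w) ^ (-2 * a) * g ((1 - w) / (1 + w))) s
      - (1 - s ^ 2) * deriv (fun w => (1 + 1 * w) ^ (-2 * a) * g ((1 - w) / (1 + w))) s
      - 2 * (c - (a + b + 1) * (1 - s ^ 2)) *
        deriv (fun w => (1 + 1 * w) ^ (-2 * a) * g ((1 - w) / (1 + w))) s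
      - 4 * a * b * s * ((1 + 1 * s) ^ (-2 * a) * g ((1 - s) / (1 + s))) = 0
    rw [e2, e1]
    rw [one_mul]
    change (1 - s) / (1 + s) * (1 - ((1 - s) / (1 + s)) ^ 2) * deriv (deriv g) ((1 - s) / (1 + s)) +
      (c - (2 - c + 4 * a) * ((1 - s) / (1 + s)) ^ 2 - (4 * b - 2 * c) * ((1 - s) / (1 + s))) *
        deriv g ((1 - s) / (1 + s)) - (2 * a * (2 * a + 1 - c) * ((1 - s) / (1 + s))
        - (2 * a * c - 4 * a * b)) * g ((1 - s) / (1 + s)) = 0 at hode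
    generalize g ((1 - s) / (1 + s)) = g0 at *
    generalize deriv g ((1 - s) / (1 + s)) = g1 at *
    generalize deriv (deriv g) ((1 - s) / (1 + s)) = g2 at *
    generalize (1 + s) ^ (-2 * a) = G at *
    refine Eq.trans ?_ (mul_eq_zero_of_right G hode)
    field_simp
    ring

/-- The Gauss hypergeometric series continues analytically to the cut plane, as a solution of the
hypergeometric equation. -/
theorem exists_solution_cutPlane {a b c : ℂ} (hc : ∀ n : ℕ, (n : ℂ) + c ≠ 0) :
    ∃ f : ℂ → ℂ, AnalyticOnNhd ℂ f cutPlane ∧ (∀ z ∈ cutPlane, SolvesHypergeometric a b c f z) ∧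
      f 0 = 1 := by
  set y : ℂ → ℂ := fun s => (1 + 1 * s) ^ (-2 * a) *
      (fun z => ∑' n, koebeCoeff a b c n * z ^ n) ((1 - s) / (1 + s)) with hy
  have hsq : ∀ z ∈ cutPlane, HasDerivAt (fun z : ℂ => (1 - z) ^ (1 / 2 : ℂ))
      (-1 / (2 * (1 - z) ^ (1 / 2 : ℂ))) z := fun z hz => by
    have hz' := mem_cutPlane_iff.1 hz
    have hne : (1 - z) ^ (1 / 2 : ℂ) ≠ 0 := fun h => by
      have := re_cpow_half_pos hz'
      rw [h] at this
      simp at this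
    have := hasDerivAt_affine_cpow (p := 1) (q := -1) (k := 1 / 2) (x := z)
      (by convert hz' using 1; ring)
    simp only [neg_one_mul, ← sub_eq_add_neg] at this
    convert! this using 1
    rw [div_eq_div_iff (by simpa using hne) (Complex.slitPlane_ne_zero hz')]
    linear_combination (cpow_half_sq (z := 1 - z))
  -- The constant 2^(2a) normalises the value at z = 0, that is s = 1, where (1 + s)^(-2a) =
  -- 2^(-2a).
  refine ⟨fun z => (2 : ℂ) ^ (2 * a) * y ((1 - z) ^ (1 / 2 : ℂ)), fun z hz => ?_, fun z hz => ?_, ?_⟩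
  · have hz' := mem_cutPlane_iff.1 hz
    have hya := (koebe_comp_ode (a := a) (b := b) hc (re_cpow_half_pos hz')).1
    exact analyticAt_const.mul (AnalyticAt.fun_comp (g := y) (f := fun z : ℂ => (1 - z) ^ (1 / 2 : ℂ))
      hya (AnalyticAt.cpow (by fun_prop) (by fun_prop) hz'))
  · have hz' := mem_cutPlane_iff.1 hz
    obtain ⟨hya, hode⟩ := koebe_comp_ode (a := a) (b := b) hc (re_cpow_half_pos hz')
    rw [← hy] at hya hode
    have hne : (1 - z) ^ (1 / 2 : ℂ) ≠ 0 := fun h => by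
      have := re_cpow_half_pos hz'
      rw [h] at this
      simp at this
    have hsq1 : HasDerivAt (fun z : ℂ => -1 / (2 * (1 - z) ^ (1 / 2 : ℂ)))
        (-1 / (4 * ((1 - z) ^ (1 / 2 : ℂ)) ^ 3)) z := by
      convert! (hasDerivAt_const z (-1 : ℂ)).div ((hsq z hz).const_mul 2) (by simpa using hne) using 1
      field_simp
      norm_num
    obtain ⟨e1, e2⟩ := deriv_mul_comp (Eventually.of_forall fun w => hasDerivAt_const w (2 ^ (2 * a) : ℂ))
      (hasDerivAt_const z 0) ((isOpen_cutPlane.eventually_mem hz).mono hsq) hsq1 hya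
    rw [SolvesHypergeometric, e2, e1]
    have hs2 := cpow_half_sq (z := 1 - z)
    generalize (1 - z) ^ (1 / 2 : ℂ) = s at *
    obtain rfl : z = 1 - s ^ 2 := by linear_combination hs2
    generalize y s = y0 at *
    generalize deriv y s = y1 at *
    generalize deriv (deriv y) s = y2 at *
    refine Eq.trans ?_ (mul_eq_zero_of_right ((2 : ℂ) ^ (2 * a) / (4 * s)) hode)
    field_simp
    ring
  · have h0 : (∑' n, koebeCoeff a b c n * (0 : ℂ) ^ n) = 1 := by
      rw [tsum_eq_single 0 fun n hn => by simp [hn]]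
      simp [koebeCoeff]
    simp only [hy, sub_zero, Complex.one_cpow, sub_self, zero_div, h0, mul_one]
    rw [show (1 + 1 : ℂ) = 2 by norm_num, ← Complex.cpow_add _ _ two_ne_zero]
    simp

/-- Uniqueness of the regular solution of the hypergeometric equation at the origin. -/
theorem eventuallyEq_of_solvesHypergeometric {a b c : ℂ} (hc : ∀ n : ℕ, (n : ℂ) + c ≠ 0)
    {f g : ℂ → ℂ} (hf : AnalyticAt ℂ f 0) (hg : AnalyticAt ℂ g 0)
    (hfo : ∀ᶠ z in 𝓝 0, SolvesHypergeometric a b c f z)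
    (hgo : ∀ᶠ z in 𝓝 0, SolvesHypergeometric a b c g z) (h0 : f 0 = g 0) : f =ᶠ[𝓝 0] g := by
  have hd := eventually_eq_zero_of_indicial (u := f - g) (P := fun z => 1 - z)
    (Q := fun z => c - (a + b + 1) * z) (R := fun _ => -(a * b)) (hf.sub hg)
    (by fun_prop) (by fun_prop) (by fun_prop) ?_ (by simp [h0]) fun m hm => ?_
  · filter_upwards [hd] with z hz
    exact sub_eq_zero.1 hz
  · have e1 : deriv (f - g) =ᶠ[𝓝 0] deriv f - deriv g := by
      filter_upwards [hf.eventually_analyticAt, hg.eventually_analyticAt] with z h1 h2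
      exact deriv_sub h1.differentiableAt h2.differentiableAt
    filter_upwards [hfo, hgo, e1.eventually_nhds, hf.deriv.eventually_analyticAt,
      hg.deriv.eventually_analyticAt] with z h1 h2 h3 h4 h5
    have h3' : deriv (f - g) =ᶠ[𝓝 z] deriv f - deriv g := h3
    rw [h3'.deriv_eq, deriv_sub h4.differentiableAt h5.differentiableAt, h3'.eq_of_nhds]
    unfold SolvesHypergeometric at h1 h2
    simp only [Pi.sub_apply]
    linear_combination h1 - h2
  · have hm0 : m ≠ 0 := by
      rintro rfl
      exact (hf.sub hg).analyticOrderAt_ne_zero.2 (by simp [h0]) (by simpa using hm)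
    obtain ⟨n, rfl⟩ := Nat.exists_eq_succ_of_ne_zero hm0
    have := hc n
    refine mul_ne_zero (Nat.cast_ne_zero.2 hm0) ?_
    push_cast
    simpa using this

theorem IsHypergeometricContinuation.zero {a b c : ℂ} {f : ℂ → ℂ}
    (hf : IsHypergeometricContinuation a b c f) : f 0 = 1 := by
  rw [hf.eq_series 0 (by simp), ordinaryHypergeometric_zero]

/-- The global solution and the series are both regular at 0 with value 1, so they agree near 0, and
then on the disc by the identity theorem. -/
theorem exists_isHypergeometricContinuation {a b c : ℂ} (hc : ∀ n : ℕ, (n : ℂ) + c ≠ 0) :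
    ∃ f : ℂ → ℂ, IsHypergeometricContinuation a b c f ∧
      ∀ z ∈ cutPlane, SolvesHypergeometric a b c f z := by
  obtain ⟨f, hf, hode, h0⟩ := exists_solution_cutPlane (a := a) (b := b) hc
  have hF : AnalyticOnNhd ℂ (ordinaryHypergeometric a b c : ℂ → ℂ) (Metric.ball 0 1) := by
    rw [ordinaryHypergeometric_eq_tsum_coefficient]
    exact (unitDiscCoeff_ordinaryHypergeometricCoefficient a b c).analyticOnNhd
  refine ⟨f, ⟨hf, fun z hz => ?_⟩, hode⟩
  have h : f =ᶠ[𝓝 0] ordinaryHypergeometric a b c :=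
    eventuallyEq_of_solvesHypergeometric hc (hf 0 zero_mem_cutPlane) (hF 0 (by simp))
      ((isOpen_cutPlane.eventually_mem zero_mem_cutPlane).mono hode)
      ((Metric.isOpen_ball.eventually_mem (Metric.mem_ball_self one_pos)).mono fun z hz =>
        solvesHypergeometric_ordinaryHypergeometric hc (by simpa using hz))
      (by rw [h0, ordinaryHypergeometric_zero])
  exact (hf.mono ball_subset_cutPlane).eqOn_of_preconnected_of_eventuallyEq hF
    (convex_ball _ _).isPreconnected (Metric.mem_ball_self one_pos) h (by simpa using hz)

theorem SolvesHypergeometric.congr {a b c z : ℂ} {f g : ℂ → ℂ} (hfg : f =ᶠ[𝓝 z] g)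
    (hf : SolvesHypergeometric a b c f z) : SolvesHypergeometric a b c g z := by
  rw [SolvesHypergeometric] at *
  rwa [← hfg.deriv.deriv_eq, ← hfg.deriv_eq, ← hfg.eq_of_nhds]

theorem IsHypergeometricContinuation.solvesHypergeometric {a b c : ℂ}
    (hc : ∀ n : ℕ, (n : ℂ) + c ≠ 0) {f : ℂ → ℂ} (hf : IsHypergeometricContinuation a b c f)
    {z : ℂ} (hz : z ∈ cutPlane) : SolvesHypergeometric a b c f z := by
  obtain ⟨g, hg, hode⟩ := exists_isHypergeometricContinuation (a := a) (b := b) hc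
  have h : g =ᶠ[𝓝 0] f := by
    filter_upwards [Metric.isOpen_ball.eventually_mem (Metric.mem_ball_self one_pos)] with w hw
    rw [hg.eq_series w (by simpa using hw), hf.eq_series w (by simpa using hw)]
  have h' := hg.analytic.eqOn_of_preconnected_of_eventuallyEq hf.analytic isPreconnected_cutPlane
    zero_mem_cutPlane h
  exact (hode z hz).congr (h'.eventuallyEq_of_mem (isOpen_cutPlane.mem_nhds hz))

/-! ### Pfaff, rotational and quadratic transformations. -/

theorem inv_mem_slitPlane_of_mem {z : ℂ} (hz : z ∈ Complex.slitPlane) : z⁻¹ ∈ Complex.slitPlane := by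
  have h0 := Complex.normSq_pos.2 (Complex.slitPlane_ne_zero hz)
  rcases hz with h | h
  · exact Or.inl (by rw [Complex.inv_re]; positivity)
  · exact Or.inr (by rw [Complex.inv_im]; exact div_ne_zero (neg_ne_zero.2 h) h0.ne')

theorem hasDerivAt_one_sub_cpow {k x : ℂ} (hx : x ∈ cutPlane) :
    HasDerivAt (fun x => (1 - x) ^ k) (-k * (1 - x) ^ k / (1 - x)) x := by
  have := hasDerivAt_affine_cpow (p := 1) (q := -1) (k := k) (x := x)
    (by convert mem_cutPlane_iff.1 hx using 1; ring)
  simpa only [neg_one_mul, ← sub_eq_add_neg, mul_neg_one] using this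

theorem hasDerivAt_one_sub_cpow' {k x : ℂ} (hx : x ∈ cutPlane) :
    HasDerivAt (fun x => -k * (1 - x) ^ k / (1 - x))
      (k * (k - 1) * (1 - x) ^ k / (1 - x) ^ 2) x := by
  have := hasDerivAt_affine_cpow' (p := 1) (q := -1) (k := k) (x := x)
    (by convert mem_cutPlane_iff.1 hx using 1; ring)
  simpa only [neg_one_mul, ← sub_eq_add_neg, mul_neg_one, neg_one_sq, mul_one] using this

theorem one_sub_ne_zero_of_mem_cutPlane {x : ℂ} (hx : x ∈ cutPlane) : 1 - x ≠ 0 :=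
  Complex.slitPlane_ne_zero (mem_cutPlane_iff.1 hx)

theorem div_sub_one_mem_cutPlane {x : ℂ} (hx : x ∈ cutPlane) : x / (x - 1) ∈ cutPlane := by
  have h := one_sub_ne_zero_of_mem_cutPlane hx
  have h' : x - 1 ≠ 0 := by rwa [← neg_sub, neg_ne_zero]
  rw [mem_cutPlane_iff]
  convert! inv_mem_slitPlane_of_mem (mem_cutPlane_iff.1 hx) using 1
  field_simp
  ring

theorem analyticAt_one_sub_cpow {k x : ℂ} (hx : x ∈ cutPlane) :
    AnalyticAt ℂ (fun x : ℂ => (1 - x) ^ k) x :=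
  AnalyticAt.cpow (by fun_prop) (by fun_prop) (mem_cutPlane_iff.1 hx)

/-- Pfaff's transformation of the hypergeometric equation. -/
theorem SolvesHypergeometric.pfaff {a b c x : ℂ} {f : ℂ → ℂ} (hx : x ∈ cutPlane)
    (hf : AnalyticAt ℂ f (x / (x - 1))) (hode : SolvesHypergeometric a (c - b) c f (x / (x - 1))) :
    AnalyticAt ℂ (fun x => (1 - x) ^ (-a) * f (x / (x - 1))) x ∧
    SolvesHypergeometric a b c (fun x => (1 - x) ^ (-a) * f (x / (x - 1))) x := by
  have h := one_sub_ne_zero_of_mem_cutPlane hx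
  have h' : x - 1 ≠ 0 := by rwa [← neg_sub, neg_ne_zero]
  have hh : ∀ w : ℂ, w - 1 ≠ 0 → HasDerivAt (fun s => s / (s - 1)) (-1 / (w - 1) ^ 2) w :=
    fun w hw => by
      convert! (hasDerivAt_id w).div ((hasDerivAt_id w).sub_const 1) hw using 1
      simp only [id]
      ring
  have hh1 : HasDerivAt (fun w : ℂ => -1 / (w - 1) ^ 2) (2 / (x - 1) ^ 3) x := by
    convert! (hasDerivAt_const x (-1 : ℂ)).div (((hasDerivAt_id x).sub_const 1).pow 2)
      (pow_ne_zero 2 h') using 1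
    simp only [id, Pi.pow_apply]
    field_simp
    norm_num
  have hev : ∀ᶠ w in 𝓝 x, w - 1 ≠ 0 :=
    (by fun_prop : ContinuousAt (fun w : ℂ => w - 1) x).eventually_ne h'
  obtain ⟨e1, e2⟩ := deriv_mul_comp
    ((isOpen_cutPlane.eventually_mem hx).mono fun w hw => hasDerivAt_one_sub_cpow (k := -a) hw)
    (hasDerivAt_one_sub_cpow' hx) (hev.mono hh) hh1 hf
  refine ⟨(analyticAt_one_sub_cpow hx).mul (AnalyticAt.fun_comp (g := f)
    (f := fun s => s / (s - 1)) hf (by fun_prop (disch := exact h'))), ?_⟩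
  rw [SolvesHypergeometric, e2, e1]
  rw [SolvesHypergeometric] at hode
  generalize f (x / (x - 1)) = g0 at *
  generalize deriv f (x / (x - 1)) = g1 at *
  generalize deriv (deriv f) (x / (x - 1)) = g2 at *
  generalize (1 - x) ^ (-a) = G at *
  refine Eq.trans ?_ (mul_eq_zero_of_right (G / (x - 1)) hode)
  obtain ⟨y, rfl⟩ : ∃ y, x = 1 + y := ⟨x - 1, by ring⟩
  simp only [add_sub_cancel_left, sub_add_cancel_left] at h h' ⊢
  field_simp
  ring

/-- Pfaff's transformation of the hypergeometric function. -/
theorem IsHypergeometricContinuation.pfaff {a b c : ℂ} (hc : ∀ n : ℕ, (n : ℂ) + c ≠ 0)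
    {f F : ℂ → ℂ} (hf : IsHypergeometricContinuation a (c - b) c f)
    (hF : IsHypergeometricContinuation a b c F) {x : ℂ} (hx : x ∈ cutPlane) :
    F x = (1 - x) ^ (-a) * f (x / (x - 1)) := by
  have key := fun (x : ℂ) (hx : x ∈ cutPlane) => SolvesHypergeometric.pfaff hx
    (hf.analytic _ (div_sub_one_mem_cutPlane hx))
    (hf.solvesHypergeometric hc (div_sub_one_mem_cutPlane hx))
  have hev := isOpen_cutPlane.eventually_mem zero_mem_cutPlane
  refine hF.analytic.eqOn_of_preconnected_of_eventuallyEq (fun x hx => (key x hx).1)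
    isPreconnected_cutPlane zero_mem_cutPlane ?_ hx
  refine eventuallyEq_of_solvesHypergeometric hc (hF.analytic 0 zero_mem_cutPlane)
    (key 0 zero_mem_cutPlane).1 (hev.mono fun z hz => hF.solvesHypergeometric hc hz)
    (hev.mono fun z hz => (key z hz).2) ?_
  simp [hF.zero, hf.zero]

/-- For parameters `3b - 1, b, 2b`, the three exponent differences of the hypergeometric equation
coincide, and it is invariant under the rotation `x ↦ 1 / (1 - x)` of the singular points. -/
theorem SolvesHypergeometric.rotate {b x : ℂ} {f : ℂ → ℂ} (hx : x ∈ cutPlane)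
    (hf : AnalyticAt ℂ f (1 / (1 - x)))
    (hode : SolvesHypergeometric (3 * b - 1) b (2 * b) f (1 / (1 - x))) :
    AnalyticAt ℂ (fun x => (1 - x) ^ (1 - 3 * b) * f (1 / (1 - x))) x ∧
    SolvesHypergeometric (3 * b - 1) b (2 * b) (fun x => (1 - x) ^ (1 - 3 * b) * f (1 / (1 - x))) x ∧
    deriv (fun x => (1 - x) ^ (1 - 3 * b) * f (1 / (1 - x))) x =
      -(1 - 3 * b) * (1 - x) ^ (1 - 3 * b) / (1 - x) * f (1 / (1 - x)) +
        (1 - x) ^ (1 - 3 * b) * (1 / (1 - x) ^ 2) * deriv f (1 / (1 - x)) := by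
  have h := one_sub_ne_zero_of_mem_cutPlane hx
  have hh : ∀ w : ℂ, 1 - w ≠ 0 → HasDerivAt (fun s => 1 / (1 - s)) (1 / (1 - w) ^ 2) w :=
    fun w hw => by
      convert! (hasDerivAt_const w (1 : ℂ)).div ((hasDerivAt_id w).const_sub 1) hw using 1
      simp only [id]
      ring
  have hh1 : HasDerivAt (fun w : ℂ => 1 / (1 - w) ^ 2) (2 / (1 - x) ^ 3) x := by
    convert! (hasDerivAt_const x (1 : ℂ)).div (((hasDerivAt_id x).const_sub 1).pow 2)
      (pow_ne_zero 2 h) using 1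
    simp only [id, Pi.pow_apply]
    field_simp
    norm_num
  have hev : ∀ᶠ w in 𝓝 x, 1 - w ≠ 0 :=
    (by fun_prop : ContinuousAt (fun w : ℂ => 1 - w) x).eventually_ne h
  obtain ⟨e1, e2⟩ := deriv_mul_comp
    ((isOpen_cutPlane.eventually_mem hx).mono fun w hw =>
      hasDerivAt_one_sub_cpow (k := 1 - 3 * b) hw)
    (hasDerivAt_one_sub_cpow' hx) (hev.mono hh) hh1 hf
  refine ⟨(analyticAt_one_sub_cpow hx).mul (AnalyticAt.fun_comp (g := f)
    (f := fun s => 1 / (1 - s)) hf (by fun_prop (disch := exact h))), ?_, e1⟩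
  rw [SolvesHypergeometric, e2, e1]
  rw [SolvesHypergeometric] at hode
  generalize f (1 / (1 - x)) = g0 at *
  generalize deriv f (1 / (1 - x)) = g1 at *
  generalize deriv (deriv f) (1 / (1 - x)) = g2 at *
  generalize (1 - x) ^ (1 - 3 * b) = G at *
  refine Eq.trans ?_ (mul_eq_zero_of_right (-G / (1 - x)) hode)
  obtain ⟨y, rfl⟩ : ∃ y, x = 1 - y := ⟨1 - x, by ring⟩
  simp only [sub_sub_cancel] at h ⊢
  field_simp
  ring

/-- For c = 1/2 the exponents at 0 are 0 and 1/2, so the double cover w = (2x - 1)² removes that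
singularity; x = 0 and x = 1 both lie over w = 1. -/
theorem SolvesHypergeometric.even_quadratic {a b x : ℂ} {f : ℂ → ℂ}
    (hf : AnalyticAt ℂ f ((2 * x - 1) ^ 2))
    (hode : SolvesHypergeometric a b (1 / 2) f ((2 * x - 1) ^ 2)) :
    SolvesHypergeometric (2 * a) (2 * b) (a + b + 1 / 2) (fun x => f ((2 * x - 1) ^ 2)) x := by
  have hh : ∀ w : ℂ, HasDerivAt (fun s : ℂ => (2 * s - 1) ^ 2) (4 * (2 * w - 1)) w := fun w => by
    convert! (((hasDerivAt_id w).const_mul 2).sub_const 1).pow 2 using 1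
    simp only [id]
    ring
  have hh1 : HasDerivAt (fun w : ℂ => 4 * (2 * w - 1)) 8 x := by
    convert! (((hasDerivAt_id x).const_mul 2).sub_const 1).const_mul 4 using 1
    norm_num
  obtain ⟨e1, e2⟩ := deriv_mul_comp (Eventually.of_forall fun w => hasDerivAt_const w (1 : ℂ))
    (hasDerivAt_const x 0) (Eventually.of_forall hh) hh1 hf
  simp only [one_mul] at e1 e2
  rw [SolvesHypergeometric, e2, e1]
  rw [SolvesHypergeometric] at hode
  linear_combination 4 * hode

/-- This is the exponent 1/2 solution w^(1/2) F(a + 1/2, b + 1/2, 3/2 | w), with 2x - 1 as the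
square root of w. The derivative formula serves to show that it is nonzero to first order at x =
1/2. -/
theorem SolvesHypergeometric.odd_quadratic {a b x : ℂ} {f : ℂ → ℂ}
    (hf : AnalyticAt ℂ f ((2 * x - 1) ^ 2))
    (hode : SolvesHypergeometric (a + 1 / 2) (b + 1 / 2) (3 / 2) f ((2 * x - 1) ^ 2)) :
    SolvesHypergeometric (2 * a) (2 * b) (a + b + 1 / 2)
      (fun x => (2 * x - 1) * f ((2 * x - 1) ^ 2)) x ∧
    deriv (fun x => (2 * x - 1) * f ((2 * x - 1) ^ 2)) x = 2 * f ((2 * x - 1) ^ 2) +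
      (2 * x - 1) * (4 * (2 * x - 1)) * deriv f ((2 * x - 1) ^ 2) := by
  have hh : ∀ w : ℂ, HasDerivAt (fun s : ℂ => (2 * s - 1) ^ 2) (4 * (2 * w - 1)) w := fun w => by
    convert! (((hasDerivAt_id w).const_mul 2).sub_const 1).pow 2 using 1
    simp only [id]
    ring
  have hh1 : HasDerivAt (fun w : ℂ => 4 * (2 * w - 1)) 8 x := by
    convert! (((hasDerivAt_id x).const_mul 2).sub_const 1).const_mul 4 using 1
    norm_num
  have hg : ∀ w : ℂ, HasDerivAt (fun s : ℂ => 2 * s - 1) 2 w := fun w => by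
    convert! ((hasDerivAt_id w).const_mul 2).sub_const 1 using 1
    norm_num
  obtain ⟨e1, e2⟩ := deriv_mul_comp (Eventually.of_forall hg)
    (hasDerivAt_const x 2) (Eventually.of_forall hh) hh1 hf
  refine ⟨?_, e1⟩
  rw [SolvesHypergeometric, e2, e1]
  rw [SolvesHypergeometric] at hode
  linear_combination 4 * (2 * x - 1) * hode

/-- The solution `x ^ (1 - c) F(a - c + 1, b - c + 1, 2 - c | x)` when `1 - c = n + 1`. -/
theorem SolvesHypergeometric.pow_mul {a b x : ℂ} {f : ℂ → ℂ} (n : ℕ) (hf : AnalyticAt ℂ f x)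
    (hode : SolvesHypergeometric (a + n + 1) (b + n + 1) (2 + n) f x) :
    SolvesHypergeometric a b (-n) (fun x => x ^ (n + 1) * f x) x := by
  obtain ⟨e1, e2⟩ := deriv_mul_comp (g := fun x => x ^ (n + 1)) (g₁ := fun x => (n + 1) * x ^ n)
    (g₂ := (n + 1) * (n * x ^ (n - 1))) (h := fun x => x) (h₁ := fun _ => 1) (h₂ := 0) (x := x)
    (Eventually.of_forall fun w => by simpa using hasDerivAt_pow (n + 1) w)
    ((hasDerivAt_pow n x).const_mul _) (Eventually.of_forall fun w => hasDerivAt_id w)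
    (hasDerivAt_const x 1) hf
  rw [SolvesHypergeometric, e2, e1]
  rw [SolvesHypergeometric] at hode
  rcases n with _ | n
  · simp only [Nat.cast_zero] at hode ⊢
    linear_combination x * hode
  · rw [Nat.add_sub_cancel]
    push_cast at hode ⊢
    linear_combination x ^ (n + 2) * hode

/-! ### Dependence of solutions on 1-jets, and the domains in use. -/

/-- Solutions near an ordinary point are determined by their 1-jets. -/
theorem eqOn_linear_combination {a b c p α β : ℂ} {U : Set ℂ} (hU : IsOpen U)
    (hU' : IsPreconnected U) (hp : p ∈ U) (hp0 : p ≠ 0) (hp1 : p ≠ 1) {u v w : ℂ → ℂ}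
    (hu : AnalyticOnNhd ℂ u U) (hv : AnalyticOnNhd ℂ v U) (hw : AnalyticOnNhd ℂ w U)
    (huo : ∀ x ∈ U, SolvesHypergeometric a b c u x)
    (hvo : ∀ x ∈ U, SolvesHypergeometric a b c v x)
    (hwo : ∀ x ∈ U, SolvesHypergeometric a b c w x)
    (h0 : u p = α * v p + β * w p) (h1 : deriv u p = α * deriv v p + β * deriv w p)
    {x : ℂ} (hx : x ∈ U) : u x = α * v x + β * w x := by
  set d : ℂ → ℂ := fun x => u x - (α * v x + β * w x) with hd
  have hda : AnalyticOnNhd ℂ d U := fun x hx =>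
    (hu x hx).sub ((analyticAt_const.mul (hv x hx)).add (analyticAt_const.mul (hw x hx)))
  have hd1 : ∀ x ∈ U, deriv d x = deriv u x - (α * deriv v x + β * deriv w x) := fun x hx =>
    ((hu x hx).differentiableAt.hasDerivAt.sub
      (((hv x hx).differentiableAt.hasDerivAt.const_mul α).add
        ((hw x hx).differentiableAt.hasDerivAt.const_mul β))).deriv
  have hd2 : ∀ x ∈ U, deriv (deriv d) x
      = deriv (deriv u) x - (α * deriv (deriv v) x + β * deriv (deriv w) x) := fun x hx => by
    have : deriv d =ᶠ[𝓝 x] fun x => deriv u x - (α * deriv v x + β * deriv w x) :=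
      (hU.eventually_mem hx).mono hd1
    rw [this.deriv_eq]
    exact ((hu x hx).deriv.differentiableAt.hasDerivAt.sub
      (((hv x hx).deriv.differentiableAt.hasDerivAt.const_mul α).add
        ((hw x hx).deriv.differentiableAt.hasDerivAt.const_mul β))).deriv
  have hdp : d p = 0 := by simp [hd, h0]
  have hdp1 : deriv d p = 0 := by rw [hd1 p hp, h1, sub_self]
  -- Multiplication by z - p puts the ordinary point in singular form with Q p = 0. The indicial
  -- roots are then 0 and 1, and a vanishing 1-jet forces order at least 2.
  have hzero := eventually_eq_zero_of_indicial (u := d) (p := p) (P := fun z => z * (1 - z))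
    (Q := fun z => (z - p) * (c - (a + b + 1) * z)) (R := fun z => -(z - p) * (a * b)) (hda p hp)
    (by fun_prop) (by fun_prop) (by fun_prop) ?_ hdp fun m hm => ?_
  · have := hda.eqOn_zero_of_preconnected_of_eventuallyEq_zero hU' hp hzero hx
    exact sub_eq_zero.1 this
  · filter_upwards [hU.eventually_mem hp] with z hz
    have e1 := huo z hz
    have e2 := hvo z hz
    have e3 := hwo z hz
    rw [SolvesHypergeometric] at e1 e2 e3
    rw [hd1 z hz, hd2 z hz]
    simp only [hd]
    linear_combination (z - p) * (e1 - α * e2 - β * e3)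
  · have h2 : ((2 : ℕ) : ℕ∞) ≤ analyticOrderAt d p := by
      rw [natCast_le_analyticOrderAt_iff_iteratedDeriv_eq_zero (hda p hp)]
      intro i hi
      interval_cases i
      · simpa using hdp
      · simpa using hdp1
    rw [hm, Nat.cast_le] at h2
    obtain ⟨n, rfl⟩ := Nat.exists_eq_add_of_le h2
    have hn1 : (n : ℂ) + 1 ≠ 0 := Nat.cast_add_one_ne_zero n
    have hn2 : (2 : ℂ) + n ≠ 0 := by exact_mod_cast (Nat.cast_ne_zero (R := ℂ)).2 (by omega : 2 + n ≠ 0)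
    have hp1' : 1 - p ≠ 0 := sub_ne_zero.2 hp1.symm
    push_cast
    rw [sub_self, zero_mul, add_zero]
    refine mul_ne_zero hn2 (mul_ne_zero ?_ (mul_ne_zero hp0 hp1'))
    convert hn1 using 1
    ring

/-- The doubly cut plane `ℂ ∖ ((-∞, 0] ∪ [1, ∞))`. -/
def doublyCutPlane : Set ℂ := {x : ℂ | x ∈ cutPlane ∧ 1 - x ∈ cutPlane}

/-- The open upper half plane. -/
def upperHalf : Set ℂ := {x : ℂ | 0 < x.im}

theorem isOpen_doublyCutPlane : IsOpen doublyCutPlane :=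
  isOpen_cutPlane.inter (isOpen_cutPlane.preimage (by fun_prop : Continuous fun x : ℂ => 1 - x))

theorem isOpen_upperHalf : IsOpen upperHalf := isOpen_lt continuous_const Complex.continuous_im

theorem isPreconnected_upperHalf : IsPreconnected upperHalf :=
  (convex_halfSpace_im_gt 0).isPreconnected

theorem half_mem_doublyCutPlane : (1 / 2 : ℂ) ∈ doublyCutPlane := by
  constructor <;> left <;> norm_num

theorem isPreconnected_doublyCutPlane : IsPreconnected doublyCutPlane := by
  have h : StarConvex ℝ (1 / 2 : ℂ) Complex.slitPlane := by
    simpa using Complex.starConvex_ofReal_slitPlane (x := 1 / 2) (by norm_num)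
  refine (StarConvex.isPathConnected (a := 1 / 2) (fun x hx u v hu hv huv => ?_)
    half_mem_doublyCutPlane).isConnected.isPreconnected
  have huv' : (u : ℂ) + v = 1 := by exact_mod_cast huv
  constructor
  · rw [mem_cutPlane_iff]
    convert h (mem_cutPlane_iff.1 hx.1) hu hv huv using 1
    simp only [Complex.real_smul]
    linear_combination -huv'
  · rw [mem_cutPlane_iff]
    convert h (mem_cutPlane_iff.1 hx.2) hu hv huv using 1
    simp only [Complex.real_smul]
    ring

theorem upperHalf_subset_cutPlane : upperHalf ⊆ cutPlane := fun _ hx => Or.inr (ne_of_gt hx)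

theorem upperHalf_subset_doublyCutPlane : upperHalf ⊆ doublyCutPlane := fun x hx =>
  ⟨upperHalf_subset_cutPlane hx, Or.inr (by simpa using (ne_of_gt hx : x.im ≠ 0))⟩

theorem one_div_one_sub_mem_upperHalf {x : ℂ} (hx : x ∈ upperHalf) :
    1 / (1 - x) ∈ upperHalf := by
  have h := Complex.normSq_pos.2 (one_sub_ne_zero_of_mem_cutPlane (upperHalf_subset_cutPlane hx))
  change 0 < (1 / (1 - x)).im
  rw [one_div, Complex.inv_im]
  have : 0 < x.im := hx
  simp only [Complex.sub_im, Complex.one_im, zero_sub, neg_neg]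
  positivity

/-- A square lies in [1, ∞) only if its root is real of modulus at least 1, which for 2x - 1 means
that x is on one of the two cuts. -/
theorem sq_mem_cutPlane {x : ℂ} (hx : x ∈ doublyCutPlane) : (2 * x - 1) ^ 2 ∈ cutPlane := by
  obtain ⟨h1, h2⟩ := hx
  simp only [cutPlane, Set.mem_ofPred_eq, Complex.sub_re, Complex.one_re, Complex.sub_im,
    Complex.one_im, zero_sub, neg_ne_zero] at h1 h2
  have hre : ((2 * x - 1) ^ 2).re = (2 * x.re - 1) ^ 2 - (2 * x.im) ^ 2 := by
    simp [pow_two]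
  have him : ((2 * x - 1) ^ 2).im = 2 * (2 * x.re - 1) * (2 * x.im) := by
    simp [pow_two]; ring
  rw [cutPlane, Set.mem_ofPred_eq, hre, him]
  by_cases hv : x.im = 0
  · left
    have h1' : x.re < 1 := h1.resolve_right (by simp [hv])
    have h2' : 0 < x.re := by have := h2.resolve_right (by simp [hv]); linarith
    rw [hv]
    nlinarith
  · by_cases hu : 2 * x.re - 1 = 0
    · left; rw [hu]; nlinarith [sq_nonneg x.im]
    · right; exact mul_ne_zero (mul_ne_zero two_ne_zero hu) (mul_ne_zero two_ne_zero hv)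

theorem natCast_add_ne_zero_of_re_pos {c : ℂ} (hc : 0 < c.re) (n : ℕ) : (n : ℂ) + c ≠ 0 := fun h => by
  have := congrArg Complex.re h
  simp at this
  have hn : (0 : ℝ) ≤ n := n.cast_nonneg
  linarith

/-! ### The connection coefficient of the rotation. -/

/-- A nonzero solution near `0` that is invariant up to sign under Pfaff's transformation. The sign
can differ from `1` only if `exp (2 π i b) = 1`. -/
theorem exists_pfaff_eigenfunction (b : ℂ) : ∃ (φ : ℂ → ℂ) (s : ℂ), AnalyticOnNhd ℂ φ cutPlane ∧
    (∀ x ∈ cutPlane, SolvesHypergeometric (3 * b - 1) b (2 * b) φ x) ∧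
    (∃ x ∈ cutPlane, φ x ≠ 0) ∧ s ^ 2 = 1 ∧
    s * (1 - Complex.exp (2 * Real.pi * Complex.I * b)) = 1 - Complex.exp (2 * Real.pi * Complex.I * b) ∧
    ∀ x ∈ cutPlane, φ x = s * ((1 - x) ^ (1 - 3 * b) * φ (x / (x - 1))) := by
  by_cases hc : ∀ n : ℕ, (n : ℂ) + 2 * b ≠ 0
  · obtain ⟨f, hf, hode⟩ := exists_isHypergeometricContinuation (a := 3 * b - 1) (b := b) hc
    refine ⟨f, 1, hf.analytic, hode, ⟨0, zero_mem_cutPlane, by simp [hf.zero]⟩, by simp, by simp,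
      fun x hx => ?_⟩
    -- Pfaff replaces b by c - b, which is again b since c = 2b.
    have hf' : IsHypergeometricContinuation (3 * b - 1) (2 * b - b) (2 * b) f := by
      convert hf using 1; ring
    rw [one_mul, hf'.pfaff hc hf hx]
    ring_nf
  -- Here 2b = -n, and the solution of exponent 1 - c = n + 1 is taken, x^(n + 1) F(b, 1 - b, 2 + n
  -- | x). Pfaff preserves the last factor, and the sign comes from (x / (x - 1))^(n + 1).
  · push Not at hc
    obtain ⟨n, hn⟩ := hc
    have hc : ∀ m : ℕ, (m : ℂ) + (2 + n) ≠ 0 := natCast_add_ne_zero_of_re_pos (by simp; positivity)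
    obtain ⟨f, hf, hode⟩ := exists_isHypergeometricContinuation (a := b) (b := 1 - b) hc
    have hpf : ∀ x ∈ cutPlane, f x = (1 - x) ^ (-b) * f (x / (x - 1)) := fun x hx => by
      have hf' : IsHypergeometricContinuation b (2 + n - (1 - b)) (2 + n) f := by
        convert hf using 1; linear_combination hn
      exact hf'.pfaff hc hf hx
    refine ⟨fun x => x ^ (n + 1) * f x, (-1) ^ (n + 1), fun x hx => ?_, fun x hx => ?_, ?_, ?_, ?_,
      fun x hx => ?_⟩
    · exact (analyticAt_id.pow _).mul (hf.analytic x hx)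
    · have h := SolvesHypergeometric.pow_mul (a := 3 * b - 1) (b := b) n (hf.analytic x hx) (by
        have h1 := hode x hx
        rw [SolvesHypergeometric] at h1 ⊢
        rw [show (n : ℂ) = -(2 * b) by linear_combination hn] at h1 ⊢
        linear_combination h1)
      rwa [show -(n : ℂ) = 2 * b by linear_combination -hn] at h
    · have h1 : ∀ᶠ x in 𝓝 (0 : ℂ), f x ≠ 0 :=
        (hf.analytic 0 zero_mem_cutPlane).continuousAt.eventually_ne (by simp [hf.zero])
      obtain ⟨x, ⟨hx1, hx2⟩, hx3⟩ := (((h1.and (isOpen_cutPlane.eventually_mem zero_mem_cutPlane)).filter_mono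
        nhdsWithin_le_nhds).and (self_mem_nhdsWithin (a := (0 : ℂ)) (s := {0}ᶜ))).exists
      exact ⟨x, hx2, mul_ne_zero (pow_ne_zero _ hx3) hx1⟩
    · rw [← pow_mul, mul_comm, pow_mul]; simp
    · have he : Complex.exp (2 * Real.pi * Complex.I * b) = (-1) ^ n := by
        rw [show 2 * Real.pi * Complex.I * b = n * (-(Real.pi * Complex.I)) by
          linear_combination (Real.pi * Complex.I) * hn, Complex.exp_nat_mul, Complex.exp_neg,
          Complex.exp_pi_mul_I]
        norm_num
      rw [he, pow_succ]
      rcases neg_one_pow_eq_or ℂ n with h | h <;> rw [h] <;> norm_num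
    · have h0 := one_sub_ne_zero_of_mem_cutPlane hx
      have h0' : x - 1 ≠ 0 := by rwa [← neg_sub, neg_ne_zero]
      simp only
      rw [hpf x hx, show 1 - 3 * b = ((n + 1 : ℕ) : ℂ) + (-b) by push_cast; linear_combination -hn,
        Complex.cpow_add _ _ h0, Complex.cpow_natCast, div_pow]
      have : (x - 1) ^ (n + 1) = (-1) ^ (n + 1) * (1 - x) ^ (n + 1) := by rw [← mul_pow]; ring
      rw [this]
      have h3 : (1 - x) ^ (n + 1) ≠ 0 := pow_ne_zero _ h0
      have h4 : ((-1 : ℂ)) ^ (n + 1) ≠ 0 := pow_ne_zero _ (by norm_num)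
      field_simp

/-- Two linear operators on a plane, with known traces. -/
theorem coefficient_of_jets {e₀ e₁ o₀ o₁ μ ν ω τ a b s α β γ δ : ℂ} (hW : e₀ * o₁ - e₁ * o₀ ≠ 0)
    (he0 : α * e₀ + β * o₀ = μ * e₀) (he1 : α * e₁ + β * o₁ = ν * e₀ + μ * ω * e₁)
    (ho0 : γ * e₀ + δ * o₀ = μ * o₀) (ho1 : γ * e₁ + δ * o₁ = ν * o₀ + μ * ω * o₁)
    (h0 : a * (μ * e₀) - b * (μ * o₀) = s * (a * e₀ + b * o₀))
    (h1 : a * (ν * e₀ + μ * ω * e₁) - b * (ν * o₀ + μ * ω * o₁) = s * (a * e₁ + b * o₁))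
    (hab : a ≠ 0 ∨ b ≠ 0) (ht : μ * (1 + ω) = τ) (hd : μ ^ 2 * ω = τ ^ 2) (hs : s ^ 2 = 1)
    (hs' : s * (1 - τ ^ 2) = 1 - τ ^ 2) : α = (1 + τ - τ ^ 2) / 2 := by
  -- The trace and then the determinant of the rotation, computed in the basis e, o and on jets;
  -- `hW` says that the jets of e and o form a basis.
  have htr : α + δ = τ := by
    refine mul_right_cancel₀ hW ?_
    linear_combination o₁ * he0 - o₀ * he1 + e₀ * ho1 - e₁ * ho0 + (e₀ * o₁ - e₁ * o₀) * ht
  have hdet : α * δ - β * γ = τ ^ 2 := by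
    refine mul_right_cancel₀ hW ?_
    linear_combination (γ * e₁ + δ * o₁) * he0 + μ * e₀ * ho1 - (γ * e₀ + δ * o₀) * he1
      - (ν * e₀ + μ * ω * e₁) * ho0 + (e₀ * o₁ - e₁ * o₀) * hd
  have k0 : (α - s) * a = γ * b := by
    refine mul_right_cancel₀ hW ?_
    linear_combination o₁ * h0 - o₀ * h1 + a * (o₁ * he0 - o₀ * he1) - b * (o₁ * ho0 - o₀ * ho1)
  have k1 : β * a = (δ + s) * b := by
    refine mul_right_cancel₀ hW ?_
    linear_combination e₀ * h1 - e₁ * h0 + a * (e₀ * he1 - e₁ * he0) - b * (e₀ * ho1 - e₁ * ho0)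
  -- The characteristic equation of rotation after reflection at its eigenvalue s.
  have hk : (α - s) * (δ + s) = β * γ := by
    rcases hab with ha | hb
    · refine mul_right_cancel₀ ha ?_
      linear_combination (δ + s) * k0 - γ * k1
    · refine mul_right_cancel₀ hb ?_
      linear_combination β * k0 - (α - s) * k1
  -- The other eigenvalue is -τ² / s = -s τ², so the trace is s (1 - τ²).
  have hdiff : α - δ = 1 - τ ^ 2 := by
    linear_combination s * hk - s * hdet - (α - δ - s) * hs + hs'
  linear_combination (htr + hdiff) / 2

/-- A fixed point of x ↦ 1 / (1 - x) in the upper half plane makes the rotation act on 1-jets at a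
single point. -/
theorem fixedPoint_facts : ∃ p : ℂ, p = Complex.exp (Real.pi / 3 * Complex.I) ∧ p ∈ upperHalf ∧
    1 - p = Complex.exp (-(Real.pi / 3) * Complex.I) ∧ p ^ 2 = p - 1 ∧ 1 / (1 - p) = p := by
  have h1 : 1 - Complex.exp (Real.pi / 3 * Complex.I) = Complex.exp (-(Real.pi / 3) * Complex.I) := by
    have h := Complex.two_cos (Real.pi / 3)
    have hc : Complex.cos (Real.pi / 3) = 1 / 2 := by
      have := Real.cos_pi_div_three
      rw [show (Real.pi / 3 : ℂ) = ((Real.pi / 3 : ℝ) : ℂ) by push_cast; rfl, ← Complex.ofReal_cos, this]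
      norm_num
    rw [hc] at h
    linear_combination h
  have h2 : Complex.exp (Real.pi / 3 * Complex.I) * Complex.exp (-(Real.pi / 3) * Complex.I) = 1 := by
    rw [← Complex.exp_add]; simp
  refine ⟨_, rfl, ?_, h1, ?_, ?_⟩
  · change 0 < (Complex.exp (Real.pi / 3 * Complex.I)).im
    rw [show (Real.pi / 3 : ℂ) = ((Real.pi / 3 : ℝ) : ℂ) by push_cast; rfl,
      Complex.exp_ofReal_mul_I_im, Real.sin_pi_div_three]
    positivity
  · rw [← h1] at h2
    linear_combination -h2
  · rw [h1, one_div]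
    exact inv_eq_of_mul_eq_one_left h2

theorem one_sub_fixedPoint_cpow {p k : ℂ} (hp : 1 - p = Complex.exp (-(Real.pi / 3) * Complex.I)) :
    (1 - p) ^ k = Complex.exp (-(Real.pi / 3) * Complex.I * k) := by
  rw [hp, Complex.cpow_def_of_ne_zero (Complex.exp_ne_zero _), Complex.log_exp]
  · simp; linarith [Real.pi_pos]
  · simp; linarith [Real.pi_pos]

/-- Let `e`, `o` be the solutions that are even and odd about `1 / 2`. Transporting `e` by the
rotation of the three singular points gives a combination of `e` and `o` with an explicit
first coefficient. -/
theorem rotate_even_solution {b : ℂ} {e o : ℂ → ℂ} (hea : AnalyticOnNhd ℂ e doublyCutPlane)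
    (hoa : AnalyticOnNhd ℂ o doublyCutPlane)
    (heo : ∀ x ∈ doublyCutPlane, SolvesHypergeometric (3 * b - 1) b (2 * b) e x)
    (hoo : ∀ x ∈ doublyCutPlane, SolvesHypergeometric (3 * b - 1) b (2 * b) o x)
    (he : ∀ x, e (1 - x) = e x) (ho : ∀ x, o (1 - x) = -o x)
    (he1 : e (1 / 2) = 1) (ho1 : deriv o (1 / 2) ≠ 0) :
    ∃ β : ℂ, ∀ x ∈ upperHalf, (1 - x) ^ (1 - 3 * b) * e (1 / (1 - x)) =
      (1 + Complex.exp (Real.pi * Complex.I * b) - Complex.exp (Real.pi * Complex.I * b) ^ 2) / 2 * e x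
        + β * o x := by
  have hD := isOpen_doublyCutPlane
  have hHD := upperHalf_subset_doublyCutPlane
  have ho0 : o (1 / 2) = 0 := by
    have := ho (1 / 2)
    rw [show (1 : ℂ) - 1 / 2 = 1 / 2 by norm_num] at this
    linear_combination this / 2
  have hde : deriv e (1 / 2) = 0 := by
    have h1 : HasDerivAt (fun x => e (1 - x)) (deriv e (1 / 2) * -1) (1 / 2 : ℂ) := by
      refine HasDerivAt.comp (h := fun x : ℂ => 1 - x) (1 / 2 : ℂ) ?_
        ((hasDerivAt_id (1 / 2 : ℂ)).const_sub 1)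
      rw [show (1 : ℂ) - 1 / 2 = 1 / 2 by norm_num]
      exact (hea _ half_mem_doublyCutPlane).differentiableAt.hasDerivAt
    rw [funext he] at h1
    have := h1.deriv
    linear_combination this / 2
  obtain ⟨p, -, hpH, hp1, hp2, hpfix⟩ := fixedPoint_facts
  have hpD := hHD hpH
  have hpc := upperHalf_subset_cutPlane hpH
  have hp10 := one_sub_ne_zero_of_mem_cutPlane hpc
  have hp0 : p ≠ 0 := fun h => by rw [h] at hp2; norm_num at hp2
  have hpn1 : p ≠ 1 := fun h => hp10 (by rw [h, sub_self])
  -- A combination with zero jet at p vanishes on the whole doubly cut plane, and its jet at 1/2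
  -- then forces c = d = 0.
  have hindep : ∀ c d : ℂ, c * e p + d * o p = 0 → c * deriv e p + d * deriv o p = 0 →
      c = 0 ∧ d = 0 := fun c d h0 h1 => by
    have hz := fun x (hx : x ∈ doublyCutPlane) => eqOn_linear_combination (u := fun _ => 0) (α := c) (β := d) hD
      isPreconnected_doublyCutPlane hpD hp0 hpn1 (fun x _ => analyticAt_const) hea hoa
      (fun x _ => by simp [SolvesHypergeometric]) heo hoo h0.symm (by simpa using h1.symm) hx
    have hz' : (fun _ : ℂ => (0 : ℂ)) =ᶠ[𝓝 (1 / 2)] fun x => c * e x + d * o x :=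
      (hD.eventually_mem half_mem_doublyCutPlane).mono hz
    have hc : c = 0 := by
      have := hz _ half_mem_doublyCutPlane
      rw [he1, ho0] at this
      linear_combination -this
    refine ⟨hc, ?_⟩
    have h2 := (((hea _ half_mem_doublyCutPlane).differentiableAt.hasDerivAt.const_mul c).add
      ((hoa _ half_mem_doublyCutPlane).differentiableAt.hasDerivAt.const_mul d)).congr_of_eventuallyEq
      (by exact hz')
    have h3 := h2.unique (hasDerivAt_const _ _)
    rw [hc, zero_mul, zero_add] at h3
    exact (mul_eq_zero.1 h3).resolve_right ho1
  have hW : e p * deriv o p - deriv e p * o p ≠ 0 := fun hW => by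
    obtain ⟨h1, h2⟩ := hindep (o p) (-e p) (by ring) (by linear_combination -hW)
    obtain ⟨h3, -⟩ := hindep (deriv o p) (-deriv e p) (by rw [h1]; linear_combination (deriv o p) * (-h2))
      (by ring)
    obtain ⟨-, h5⟩ := hindep 0 1 (by rw [h1]; ring) (by rw [h3]; ring)
    exact one_ne_zero h5
  have hrot : ∀ f : ℂ → ℂ, AnalyticOnNhd ℂ f doublyCutPlane →
      (∀ x ∈ doublyCutPlane, SolvesHypergeometric (3 * b - 1) b (2 * b) f x) → ∀ x ∈ upperHalf,
      AnalyticAt ℂ (fun x => (1 - x) ^ (1 - 3 * b) * f (1 / (1 - x))) x ∧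
      SolvesHypergeometric (3 * b - 1) b (2 * b) (fun x => (1 - x) ^ (1 - 3 * b) * f (1 / (1 - x))) x ∧
      deriv (fun x => (1 - x) ^ (1 - 3 * b) * f (1 / (1 - x))) x =
      -(1 - 3 * b) * (1 - x) ^ (1 - 3 * b) / (1 - x) * f (1 / (1 - x)) +
        (1 - x) ^ (1 - 3 * b) * (1 / (1 - x) ^ 2) * deriv f (1 / (1 - x)) := fun f hf hfo x hx =>
    SolvesHypergeometric.rotate (upperHalf_subset_cutPlane hx)
      (hf _ (hHD (one_div_one_sub_mem_upperHalf hx))) (hfo _ (hHD (one_div_one_sub_mem_upperHalf hx)))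
  set μ : ℂ := (1 - p) ^ (1 - 3 * b) with hμ
  set ν : ℂ := -(1 - 3 * b) * μ / (1 - p) with hν
  -- The derivative of 1 / (1 - x) at p is 1 / (1 - p)² = p², which yields the second diagonal entry
  -- μ p².
  have hjet : ∀ f : ℂ → ℂ, AnalyticOnNhd ℂ f doublyCutPlane →
      (∀ x ∈ doublyCutPlane, SolvesHypergeometric (3 * b - 1) b (2 * b) f x) →
      deriv (fun x => (1 - x) ^ (1 - 3 * b) * f (1 / (1 - x))) p = ν * f p + μ * p ^ 2 * deriv f p :=
    fun f hf hfo => by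
      rw [(hrot f hf hfo p hpH).2.2, ← one_div_pow, hpfix]
  have hcomb : ∀ f : ℂ → ℂ, AnalyticOnNhd ℂ f doublyCutPlane →
      (∀ x ∈ doublyCutPlane, SolvesHypergeometric (3 * b - 1) b (2 * b) f x) → ∃ α β : ℂ,
      α * e p + β * o p = μ * f p ∧
      α * deriv e p + β * deriv o p = ν * f p + μ * p ^ 2 * deriv f p ∧
      ∀ x ∈ upperHalf, (1 - x) ^ (1 - 3 * b) * f (1 / (1 - x)) = α * e x + β * o x :=
    fun f hf hfo => by
      set y₀ := μ * f p
      set y₁ := ν * f p + μ * p ^ 2 * deriv f p with hy₁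
      -- The coefficients are those of Cramer's rule for the jets at p.
      have k0 : (y₀ * deriv o p - y₁ * o p) / (e p * deriv o p - deriv e p * o p) * e p
          + (y₁ * e p - y₀ * deriv e p) / (e p * deriv o p - deriv e p * o p) * o p = y₀ := by
        rw [div_mul_eq_mul_div, div_mul_eq_mul_div, ← add_div, div_eq_iff hW]
        ring
      have k1 : (y₀ * deriv o p - y₁ * o p) / (e p * deriv o p - deriv e p * o p) * deriv e p
          + (y₁ * e p - y₀ * deriv e p) / (e p * deriv o p - deriv e p * o p) * deriv o p = y₁ := by
        rw [div_mul_eq_mul_div, div_mul_eq_mul_div, ← add_div, div_eq_iff hW]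
        ring
      refine ⟨_, _, k0, k1, fun x hx => eqOn_linear_combination isOpen_upperHalf
        isPreconnected_upperHalf hpH hp0 hpn1 (fun x hx => (hrot f hf hfo x hx).1) (hea.mono hHD)
        (hoa.mono hHD) (fun x hx => (hrot f hf hfo x hx).2.1) (fun x hx => heo x (hHD hx))
        (fun x hx => hoo x (hHD hx)) ?_ ?_ hx⟩
      · rw [k0, hpfix]
      · rw [k1, hjet f hf hfo]
  obtain ⟨α, β, he0', he1', hα⟩ := hcomb e hea heo
  obtain ⟨γ, δ, ho0', ho1', -⟩ := hcomb o hoa hoo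
  obtain ⟨φ, s, hφa, hφo, ⟨x₀, hx₀, hφx₀⟩, hs, hs', hφ⟩ := exists_pfaff_eigenfunction b
  set a₀ := φ (1 / 2)
  set b₀ := deriv φ (1 / 2) / deriv o (1 / 2) with hb₀
  have hφeo : ∀ x ∈ doublyCutPlane, φ x = a₀ * e x + b₀ * o x := fun x hx =>
    eqOn_linear_combination hD isPreconnected_doublyCutPlane half_mem_doublyCutPlane
      (by norm_num) (by norm_num) (fun x hx => hφa x hx.1) hea hoa (fun x hx => hφo x hx.1) heo hoo
      (by rw [he1, ho0]; ring) (by rw [hde, hb₀]; field_simp; ring) hx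
  have hab : a₀ ≠ 0 ∨ b₀ ≠ 0 := by
    by_contra! h
    have hd0 : deriv φ (1 / 2) = 0 := (div_eq_zero_iff.1 h.2).resolve_right ho1
    refine hφx₀ ?_
    have := eqOn_linear_combination (v := fun _ => 0) (w := fun _ => 0) (α := 0) (β := 0)
      isOpen_cutPlane isPreconnected_cutPlane half_mem_doublyCutPlane.1 (by norm_num) (by norm_num)
      hφa (fun x _ => analyticAt_const) (fun x _ => analyticAt_const) hφo
      (fun x _ => by simp [SolvesHypergeometric]) (fun x _ => by simp [SolvesHypergeometric])
      (h.1.trans (by ring)) (by rw [hd0]; ring) hx₀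
    simpa using this
  -- Since x / (x - 1) = 1 - 1 / (1 - x), Pfaff's transformation is the reflection followed by the
  -- rotation; the reflection changes the sign of o.
  have hrel : ∀ x ∈ upperHalf, a₀ * ((1 - x) ^ (1 - 3 * b) * e (1 / (1 - x)))
      - b₀ * ((1 - x) ^ (1 - 3 * b) * o (1 / (1 - x))) = s * (a₀ * e x + b₀ * o x) := fun x hx => by
    have hx1 := one_sub_ne_zero_of_mem_cutPlane (upperHalf_subset_cutPlane hx)
    have hx1' : x - 1 ≠ 0 := by rwa [← neg_sub, neg_ne_zero]
    have hy := hHD (one_div_one_sub_mem_upperHalf hx)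
    have hy' : 1 - 1 / (1 - x) ∈ doublyCutPlane := ⟨hy.2, by simpa using hy.1⟩
    have h1 := hφeo _ hy'
    rw [he, ho, show 1 - 1 / (1 - x) = x / (x - 1) by field_simp; ring] at h1
    rw [← hφeo x (hHD hx), hφ x (upperHalf_subset_cutPlane hx), h1]
    linear_combination -((1 - x) ^ (1 - 3 * b) * (a₀ * e (1 / (1 - x)) - b₀ * o (1 / (1 - x)))) * hs
  have hr0 := hrel p hpH
  have hr1 : a₀ * deriv (fun x => (1 - x) ^ (1 - 3 * b) * e (1 / (1 - x))) p
      - b₀ * deriv (fun x => (1 - x) ^ (1 - 3 * b) * o (1 / (1 - x))) p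
      = s * (a₀ * deriv e p + b₀ * deriv o p) := by
    have h1 := ((hrot e hea heo p hpH).1.differentiableAt.hasDerivAt.const_mul a₀).sub
      ((hrot o hoa hoo p hpH).1.differentiableAt.hasDerivAt.const_mul b₀)
    have h2 := (((hea p hpD).differentiableAt.hasDerivAt.const_mul a₀).add
      ((hoa p hpD).differentiableAt.hasDerivAt.const_mul b₀)).const_mul s
    have h3 : (fun x => a₀ * ((1 - x) ^ (1 - 3 * b) * e (1 / (1 - x)))
      - b₀ * ((1 - x) ^ (1 - 3 * b) * o (1 / (1 - x)))) =ᶠ[𝓝 p] fun x => s * (a₀ * e x + b₀ * o x) :=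
      (isOpen_upperHalf.eventually_mem hpH).mono hrel
    exact (h1.congr_of_eventuallyEq h3.symm).unique h2
  rw [hpfix, ← hμ] at hr0
  rw [hjet e hea heo, hjet o hoa hoo] at hr1
  -- μ p = exp(-(πi/3)(1 - 3b)) exp(πi/3) = exp(πib); with 1 + p² = p this is the trace μ (1 + p²).
  have hτ : μ * p = Complex.exp (Real.pi * Complex.I * b) := by
    obtain ⟨q, hq, -, hq1, -, -⟩ := fixedPoint_facts
    have hpq : p = q := by linear_combination hq1 - hp1
    rw [hμ, one_sub_fixedPoint_cpow hp1, hpq, hq, ← Complex.exp_add]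
    congr 1
    ring
  have hτ2 : Complex.exp (2 * Real.pi * Complex.I * b) = Complex.exp (Real.pi * Complex.I * b) ^ 2 := by
    rw [← Complex.exp_nat_mul]
    congr 1
    push_cast
    ring
  rw [hτ2] at hs'
  have hfin := coefficient_of_jets hW he0' he1' ho0' ho1' hr0 hr1 hab
    (τ := Complex.exp (Real.pi * Complex.I * b)) (by rw [← hτ, hp2]; ring) (by rw [← hτ]; ring) hs hs'
  exact ⟨β, fun x hx => by rw [hα x hx, hfin]⟩

/-! ### Evaluation at 9. -/

theorem half_cpow_neg_six_mul (t : ℂ) : (1 / 2 : ℂ) ^ (-(6 * t)) = 64 ^ t := by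
  have h1 : Complex.log (1 / 2) = ((-Real.log 2 : ℝ) : ℂ) := by
    rw [← Real.log_inv, Complex.ofReal_log (by norm_num)]
    norm_num
  have h2 : Complex.log 64 = ((6 * Real.log 2 : ℝ) : ℂ) := by
    have : 6 * Real.log 2 = Real.log 64 := by
      rw [show (64 : ℝ) = 2 ^ 6 by norm_num, Real.log_pow]
      norm_num
    rw [this, Complex.ofReal_log (by norm_num)]
    norm_num
  rw [Complex.cpow_def_of_ne_zero (by norm_num), Complex.cpow_def_of_ne_zero (by norm_num), h1, h2]
  push_cast
  ring_nf

theorem nine_cpow_half : (9 : ℂ) ^ (1 / 2 : ℂ) = 3 := by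
  have h9 : (9 : ℂ) ∈ Complex.slitPlane := Or.inl (by norm_num)
  have h1 := re_cpow_half_pos h9
  have h2 := cpow_half_sq (z := 9)
  have h3 : ((9 : ℂ) ^ (1 / 2 : ℂ) - 3) * ((9 : ℂ) ^ (1 / 2 : ℂ) + 3) = 0 := by
    linear_combination h2
  rcases mul_eq_zero.1 h3 with h | h
  · linear_combination h
  · rw [eq_neg_of_add_eq_zero_left h] at h1
    norm_num at h1

theorem cpow_half_mem_upperHalf {z : ℂ} (hz : z ∈ upperHalf) : z ^ (1 / 2 : ℂ) ∈ upperHalf := by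
  have h1 := re_cpow_half_pos (z := z) (Or.inr (ne_of_gt hz))
  have h2 : 0 < ((z ^ (1 / 2 : ℂ)) ^ 2).im := by rw [cpow_half_sq]; exact hz
  change 0 < (z ^ (1 / 2 : ℂ)).im
  rw [pow_two, Complex.mul_im] at h2
  nlinarith

theorem mainTheorem8 (t : ℂ) :
    HypergeometricUpperValue (3 * t) (t + 1 / 6) (1 / 2) 9
      (1 / (2 * (64 : ℂ) ^ t) *
        (1 + Complex.exp (2 * Real.pi * Complex.I * (t + 1 / 6))
          - Complex.exp (4 * Real.pi * Complex.I * (t + 1 / 6)))) := by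
  have hc1 : ∀ n : ℕ, (n : ℂ) + 1 / 2 ≠ 0 := natCast_add_ne_zero_of_re_pos (by norm_num)
  have hc2 : ∀ n : ℕ, (n : ℂ) + 3 / 2 ≠ 0 := natCast_add_ne_zero_of_re_pos (by norm_num)
  refine ⟨(exists_isHypergeometricContinuation hc1).imp fun f hf => hf.1, fun f hf => ?_⟩
  obtain ⟨g, hg, hgo⟩ := exists_isHypergeometricContinuation (a := 3 * t + 1 / 2)
    (b := t + 1 / 6 + 1 / 2) hc2
  have hparam : ∀ {u : ℂ → ℂ} {x : ℂ},
      SolvesHypergeometric (2 * (3 * t)) (2 * (t + 1 / 6)) (3 * t + (t + 1 / 6) + 1 / 2) u x →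
      SolvesHypergeometric (3 * (2 * t + 1 / 3) - 1) (2 * t + 1 / 3) (2 * (2 * t + 1 / 3)) u x := by
    intro u x h
    rw [SolvesHypergeometric] at h ⊢
    linear_combination h
  set e : ℂ → ℂ := fun x => f ((2 * x - 1) ^ 2) with he
  set o : ℂ → ℂ := fun x => (2 * x - 1) * g ((2 * x - 1) ^ 2) with ho
  have hea : AnalyticOnNhd ℂ e doublyCutPlane := fun x hx =>
    AnalyticAt.fun_comp (g := f) (f := fun x => (2 * x - 1) ^ 2)
      (hf.analytic _ (sq_mem_cutPlane hx)) (by fun_prop)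
  have hoa : AnalyticOnNhd ℂ o doublyCutPlane := fun x hx =>
    AnalyticAt.fun_mul (by fun_prop) (AnalyticAt.fun_comp (g := g) (f := fun x => (2 * x - 1) ^ 2)
      (hg.analytic _ (sq_mem_cutPlane hx)) (by fun_prop))
  have hodd := fun x (hx : x ∈ doublyCutPlane) => SolvesHypergeometric.odd_quadratic
    (hg.analytic _ (sq_mem_cutPlane hx)) (hgo _ (sq_mem_cutPlane hx))
  have he1 : e (1 / 2) = 1 := by simp [he, hf.zero]
  have ho1 : o (1 / 2) = 0 := by simp [ho]
  obtain ⟨β, hβ⟩ := rotate_even_solution (b := 2 * t + 1 / 3) hea hoa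
    (fun x hx => hparam (SolvesHypergeometric.even_quadratic
      (hf.analytic _ (sq_mem_cutPlane hx)) (hf.solvesHypergeometric hc1 (sq_mem_cutPlane hx))))
    (fun x hx => hparam (hodd x hx).1)
    (fun x => by simp only [he]; ring_nf) (fun x => by simp only [ho]; ring_nf) he1
    (by rw [ho, (hodd _ half_mem_doublyCutPlane).2]; simp [hg.zero])
  set α : ℂ := (1 + Complex.exp (Real.pi * Complex.I * (2 * t + 1 / 3))
    - Complex.exp (Real.pi * Complex.I * (2 * t + 1 / 3)) ^ 2) / 2 with hα
  rw [show 1 - 3 * (2 * t + 1 / 3) = -(6 * t) by ring] at hβ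
  -- A branch of the inverse of x ↦ (2x - 1)² preserving the upper half plane, with X 9 = 2.
  set X : ℂ → ℂ := fun z => (1 + z ^ (1 / 2 : ℂ)) / 2 with hX
  -- The point 1 - 1 / X is carried to X by the rotation and equals 1/2 at z = 9. Unlike f, the
  -- right side is continuous across the cut there, which gives the limit.
  have hrep : ∀ z ∈ upperHalf, f z
      = (α * e (1 - 1 / X z) + β * o (1 - 1 / X z)) / (1 / X z) ^ (-(6 * t)) := fun z hz => by
    have hw := cpow_half_mem_upperHalf hz
    have hXH : X z ∈ upperHalf := by
      change 0 < ((1 + z ^ (1 / 2 : ℂ)) / 2).im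
      have : 0 < (z ^ (1 / 2 : ℂ)).im := hw
      simp only [Complex.div_ofNat_im, Complex.add_im, Complex.one_im, zero_add]
      positivity
    have hX0 : X z ≠ 0 := fun h => by
      have : 0 < (X z).im := hXH
      simp [h] at this
    have hy : 1 - 1 / X z ∈ upperHalf := by
      have h1 : 0 < (X z).im := hXH
      have h2 := Complex.normSq_pos.2 hX0
      change 0 < (1 - 1 / X z).im
      rw [one_div, Complex.sub_im, Complex.inv_im, Complex.one_im, zero_sub, neg_div, neg_neg]
      positivity
    have h := hβ _ hy
    rw [sub_sub_cancel, one_div_one_div] at h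
    have hfe : e (X z) = f z := by
      have : (2 * X z - 1) ^ 2 = z := by
        rw [show 2 * X z - 1 = z ^ (1 / 2 : ℂ) by simp only [hX]; ring, cpow_half_sq]
      simp only [he, this]
    rw [← h, hfe, mul_div_cancel_left₀]
    rw [Complex.cpow_def_of_ne_zero (one_div_ne_zero hX0)]
    exact Complex.exp_ne_zero _
  have hX9 : X 9 = 2 := by simp only [hX, nine_cpow_half]; norm_num
  have h9 : (9 : ℂ) ∈ Complex.slitPlane := Or.inl (by norm_num)
  have hXc : ContinuousAt X 9 :=
    (continuousAt_const.add (continuousAt_id.cpow continuousAt_const h9)).div_const 2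
  have hXc' : ContinuousAt (fun z => 1 / X z) 9 :=
    continuousAt_const.div hXc (by rw [hX9]; norm_num)
  have hy9 : 1 - 1 / X 9 = 1 / 2 := by rw [hX9]; norm_num
  have hYc : ContinuousAt (fun z => 1 - 1 / X z) 9 := continuousAt_const.sub hXc'
  have hec : ContinuousAt (fun z => e (1 - 1 / X z)) 9 := by
    refine ContinuousAt.comp (g := e) (f := fun z => 1 - 1 / X z) ?_ hYc
    rw [hy9]
    exact (hea _ half_mem_doublyCutPlane).continuousAt
  have hoc : ContinuousAt (fun z => o (1 - 1 / X z)) 9 := by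
    refine ContinuousAt.comp (g := o) (f := fun z => 1 - 1 / X z) ?_ hYc
    rw [hy9]
    exact (hoa _ half_mem_doublyCutPlane).continuousAt
  have hpow : (1 / X 9) ^ (-(6 * t)) = 64 ^ t := by rw [hX9, half_cpow_neg_six_mul]
  have h64 : (64 : ℂ) ^ t ≠ 0 := by
    rw [Complex.cpow_def_of_ne_zero (by norm_num)]
    exact Complex.exp_ne_zero _
  have hcont : ContinuousAt (fun z => (α * e (1 - 1 / X z) + β * o (1 - 1 / X z))
      / (1 / X z) ^ (-(6 * t))) 9 := by
    refine ((continuousAt_const.mul hec).add (continuousAt_const.mul hoc)).div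
      (hXc'.cpow continuousAt_const ?_) (by rw [hpow]; exact h64)
    rw [hX9]
    exact Or.inl (by norm_num)
  have hlim := hcont.tendsto
  rw [hy9, he1, ho1, hpow] at hlim
  have hval : (α * 1 + β * 0) / 64 ^ t = 1 / (2 * (64 : ℂ) ^ t) *
        (1 + Complex.exp (2 * Real.pi * Complex.I * (t + 1 / 6))
          - Complex.exp (4 * Real.pi * Complex.I * (t + 1 / 6))) := by
    have h1 : Complex.exp (Real.pi * Complex.I * (2 * t + 1 / 3))
        = Complex.exp (2 * Real.pi * Complex.I * (t + 1 / 6)) := by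
      congr 1; ring
    have h2 : Complex.exp (2 * Real.pi * Complex.I * (t + 1 / 6)) ^ 2
        = Complex.exp (4 * Real.pi * Complex.I * (t + 1 / 6)) := by
      rw [← Complex.exp_nat_mul]
      congr 1; push_cast; ring
    rw [hα, h1, h2]
    field_simp
    ring
  rw [hval] at hlim
  have hpath : Tendsto (fun ε : ℝ => ((9 : ℝ) : ℂ) + (ε : ℂ) * Complex.I) (𝓝[>] 0) (𝓝 9) := by
    have : ContinuousAt (fun ε : ℝ => ((9 : ℝ) : ℂ) + (ε : ℂ) * Complex.I) 0 := by fun_prop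
    have h := this.tendsto
    simp only [Complex.ofReal_zero, zero_mul, add_zero, Complex.ofReal_ofNat] at h ⊢
    exact h.mono_left nhdsWithin_le_nhds
  refine (hlim.comp hpath).congr' ?_
  filter_upwards [self_mem_nhdsWithin] with ε hε
  refine (hrep _ ?_).symm
  change 0 < (((9 : ℝ) : ℂ) + (ε : ℂ) * Complex.I).im
  simpa using hε
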